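/- Let $d\in\{2,3\}$, $k\ge 1$, $k'\in\{k,k-1\}$, $\gamma_0>0$, $N_0\in\mathbb N$. For $d=2$ read "polygon, edge" for "polyhedron, face". $\mathbb P_j$ is the space of polynomials of degree $\le j$ ($\mathbb P_{-1}=\{0\}$), $\|\cdot\|_{0,D}$ is the $L^2(D)$ norm, $|\cdot|_{1,D}$ the $H^1(D)$ seminorm. **Meshes.** Let $\Omega\subset\mathbb R^d$ be a bounded polyhedral domain, $\Gamma=\partial\Omega$, and $\mathcal T_h$ a tessellation of $\Omega$ into finitely many polyhedra $K$ with diameter $h_K$ and set of faces $\mathcal F_K$; $\mathcal F^\partial$ is the set of faces lying on $\Gamma$, and for $f\in\mathcal F^\partial\cap\mathcal F_K$ put $\tilde h_f=h_K$. Call $\mathcal T_h$ *$(\gamma_0,N_0)$-regular* if every $K$ is star shaped with respect to all points of a ball of radius $\ge\gamma_0h_K$ and has at most $N_0$ faces and, if $d=3$, every face $f$ is star shaped with respect to all points of a disc of radius $\ge\gamma_0 h_f$ ($h_f$ the diameter of $f$) and has at most $N_0$ edges. **Projections.** $\Pi^{0,j}_D$ is the $L^2(D)$ orthogonal projection onto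 $\mathbb P_j(D)$. $\Pi^{\nabla,k}_D v\in\mathbb P_k(D)$ is given by $\int_D\nabla\Pi^{\nabla,k}_D v\cdot\nabla w=\int_D\nabla v\cdot\nabla w$ for all $w\in\mathbb P_k(D)$ and $\int_{\partial D}\Pi^{\nabla,k}_Dv=\int_{\partial D}v$. Put $(\Pi^\nabla v)|_K=\Pi^{\nabla,k}_K(v|_K)$ and $(\Pi^0_\partial v)|_f=\Pi^{0,k'}_f(v|_f)$ for $f\in\mathcal F^\partial$. **Discrete spaces.** If $d=2$, $V^f_k=\mathbb P_k(f)$. If $d=3$, choose for every face $f$ bases $\mathcal M_{k-2}\subset\mathcal M_k$ of $\mathbb P_{k-2}(f)$ and $\mathbb P_k(f)$; $V^f_k$ is the set of $v\in C^0(f)\cap H^1(f)$ with $v|_e\in\mathbb P_k(e)$ for every edge $e$ of $f$, $\Delta v\in\mathbb P_k(f)$, and $\int_f q\,v=\int_f q\,\Pi^{\nabla,k}_fv$ for all $q\in\mathcal M_k\setminus\mathcal M_{k-2}$. Let $\mathbb B_k(\partial K)=\{g\in C^0(\partial K): g|_f\in V^f_k\ \forall f\in\mathcal F_K\}$, $V^K_k=\{v\in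 H^1(K): v|_{\partial K}\in\mathbb B_k(\partial K),\ \Delta v\in\mathbb P_{k-2}(K)\}$, $V_h=\{v\in H^1(\Omega): v|_K\in V^K_k\ \forall K\}$, and let $\Lambda_h=\mathbb P_{k'}(\mathcal F^\partial)$ be the functions on $\Gamma$ that are polynomials of degree $\le k'$ on each $f\in\mathcal F^\partial$. **Form and norms.** Let $a^K(\phi,\psi)=\int_K\nabla\phi\cdot\nabla\psi$, and let $S^K_a$ be symmetric bilinear forms on $V^K_k$ such that, with constants $c_*,C^*>0$ independent of $K$, $c_*a^K(\phi,\phi)\le S^K_a(\phi,\phi)\le C^*a^K(\phi,\phi)$ whenever $\phi\in V^K_k$, $\Pi^{\nabla,k}_K\phi=0$. Put $a_h(u,v)=\sum_K\big[a^K(\Pi^\nabla u,\Pi^\nabla v)+S^K_a(u-\Pi^\nabla u,v-\Pi^\nabla v)\big]$ and, for $\alpha>0$ and with $\nu$ the outer unit normal on $\Gamma$, $$\mathfrak a_h^{BH}(u,\lambda;v,\mu)=a_h(u,v)+\int_\Gamma\lambda v+\int_\Gamma\mu u-\alpha\sum_{f\in\mathcal F^\partial}\tilde h_f\int_f(\lambda+\partial_\nu\Pi^\nabla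 u)(\mu+\partial_\nu\Pi^\nabla v),$$ $$\|\mu\|_{-1/2,h}^2=\sum_{f\in\mathcal F^\partial}\tilde h_f\|\mu\|_{0,f}^2,\qquad \|v\|_{1,h}^2=\sum_K|v|_{1,K}^2+\sum_{f\in\mathcal F^\partial}\tilde h_f^{-1}\|\Pi^0_\partial v\|_{0,f}^2 .$$ **Lemma.** 1. There is $C_{\rm inv}>0$, depending only on $d,k,\gamma_0,N_0$, such that every $(\gamma_0,N_0)$-regular tessellation satisfies $$\|p\|_{0,\partial K}\le C_{\rm inv}\,h_K^{-1/2}\|p\|_{0,K}\qquad\text{for all }K\in\mathcal T_h,\ p\in\mathbb P_k(K).\tag{$*$}$$ 2. There is $C>0$, depending only on $d,k,k',\gamma_0,N_0,c_*,C^*$, such that for every $(\gamma_0,N_0)$-regular tessellation, all $\alpha>0$, all $u_h,v_h\in V_h$ and all $\lambda_h,\mu_h\in\Lambda_h$ $$\mathfrak a_h^{BH}(u_h,\lambda_h;v_h,\mu_h)\le C(1+\alpha)\big(\|u_h\|_{1,h}+\|\lambda_h\|_{-1/2,h}\big)\big(\|v_h\|_{1,h}+\|\mu_h\|_{-1/2,h}\big).$$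 3. Let $C_{\rm inv}>0$ and $\alpha_0=\min\{1,2/(3C_{\rm inv}^2)\}$ (which does not involve $c_*$ and $C^*$). If $0<\alpha<\alpha_0$, there is $\beta>0$, depending only on $d,k,k',\gamma_0,N_0,C_{\rm inv},\alpha,c_*,C^*$, such that for every $(\gamma_0,N_0)$-regular tessellation that satisfies $(*)$ with this $C_{\rm inv}$, all $u_h\in V_h$ and all $\lambda_h\in\Lambda_h$ $$\sup_{(v_h,\mu_h)\in V_h\times\Lambda_h}\frac{\mathfrak a_h^{BH}(u_h,\lambda_h;v_h,\mu_h)}{\|v_h\|_{1,h}+\|\mu_h\|_{-1/2,h}}\ge\beta\big(\|u_h\|_{1,h}+\|\lambda_h\|_{-1/2,h}\big),$$ the supremum being over the pairs with nonzero denominator. -/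

import Mathlib

noncomputable section

open MeasureTheory Filter Topology
open scoped Classical

namespace BHVEM

/-- Euclidean space `ℝⁿ`. -/
abbrev E (n : ℕ) : Type := EuclideanSpace ℝ (Fin n)

/-! ### Polynomials -/

/-- A polynomial in `n` variables viewed as a function on `ℝⁿ`. -/
def polyEval (n : ℕ) : MvPolynomial (Fin n) ℝ →ₗ[ℝ] (E n → ℝ) :=
  LinearMap.pi fun x => (MvPolynomial.aeval (fun i => x i)).toLinearMap

/-- `ℙ_j`: the polynomial functions on `ℝⁿ` of total degree at most `j`. The index is an integer,
and `ℙ_j = {0}` for negative `j`. -/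
def P (n : ℕ) (j : ℤ) : Submodule ℝ (E n → ℝ) :=
  (MvPolynomial.restrictSupport ℝ {s : Fin n →₀ ℕ | (s.degree : ℤ) ≤ j}).map (polyEval n)

/-! ### Sobolev functions on an open set -/

/-- `u ∈ L²(D)` has the weak gradient `G ∈ L²(D)ⁿ` on `D`. -/
def IsWeakGrad {n : ℕ} (D : Set (E n)) (u : E n → ℝ) (G : E n → E n) : Prop :=
  MemLp u 2 (volume.restrict D) ∧ MemLp G 2 (volume.restrict D) ∧
    ∀ φ : E n → ℝ, ContDiff ℝ (⊤ : ℕ∞) φ → HasCompactSupport φ → tsupport φ ⊆ D →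
      ∫ x in D, u x • gradient φ x = - ∫ x in D, φ x • G x

/-- `u ∈ H¹(D)`. -/
def MemH1 {n : ℕ} (D : Set (E n)) (u : E n → ℝ) : Prop := ∃ G, IsWeakGrad D u G

/-- The weak gradient on `D` of `u ∈ H¹(D)` (unique almost everywhere on `D`). -/
def wgrad {n : ℕ} (D : Set (E n)) (u : E n → ℝ) : E n → E n :=
  if h : MemH1 D u then h.choose else 0

/-- The Dirichlet form `a^D(φ, ψ) = ∫_D ∇φ · ∇ψ` on `H¹(D)`. -/
def dirichlet {n : ℕ} (D : Set (E n)) (φ ψ : E n → ℝ) : ℝ :=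
  ∫ x in D, inner ℝ (wgrad D φ x) (wgrad D ψ x)

/-- `Δu = r` on `D` in the weak sense, for `u ∈ H¹(D)`. -/
def HasWeakLaplacian {n : ℕ} (D : Set (E n)) (u r : E n → ℝ) : Prop :=
  ∀ φ : E n → ℝ, ContDiff ℝ (⊤ : ℕ∞) φ → HasCompactSupport φ → tsupport φ ⊆ D →
    ∫ x in D, inner ℝ (wgrad D u x) (gradient φ x) = - ∫ x in D, r x * φ x

/-- `p` is the `L²(D)` orthogonal projection of `w` onto `ℙ_j(D)`. -/
def IsL2Proj {n : ℕ} (D : Set (E n)) (j : ℤ) (w p : E n → ℝ) : Prop :=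
  p ∈ P n j ∧ ∀ q ∈ P n j, ∫ x in D, p x * q x = ∫ x in D, w x * q x

/-- The projection `Π^{0,j}_D`. -/
def l2Proj {n : ℕ} (D : Set (E n)) (j : ℤ) (w : E n → ℝ) : E n → ℝ :=
  if h : ∃ p, IsL2Proj D j w p then h.choose else 0

/-- The first condition in the definition of `p = Π^{∇,k}_D v`: the polynomial `p` of degree at
most `k` satisfies `∫_D ∇p · ∇w = ∫_D ∇v · ∇w` for all `w ∈ ℙ_k(D)`. The second condition, which
fixes the additive constant through the mean value on the boundary, is added where it is used. -/
def IsGradProj {n : ℕ} (D : Set (E n)) (k : ℕ) (v p : E n → ℝ) : Prop :=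
  p ∈ P n k ∧ ∀ w ∈ P n k,
    ∫ x in D, inner ℝ (gradient p x) (gradient w x) =
      ∫ x in D, inner ℝ (wgrad D v x) (gradient w x)

/-! ### Tessellations -/

/-- Bounded connected nonempty open sets without slits or punctures. -/
def IsBoundedDomain {n : ℕ} (D : Set (E n)) : Prop :=
  IsOpen D ∧ IsConnected D ∧ Bornology.IsBounded D ∧ interior (closure D) = D

/-- A tessellation of `Ω ⊆ ℝ^{n+1}` (used for `n = 1` and `n = 2`) into finitely many
polygonal/polyhedral elements. Elements are given by their interiors. A face is
given by its relative interior, the image of a domain `dom f ⊆ ℝⁿ` under an affine isometry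
`chart f : ℝⁿ → ℝ^{n+1}`; hence the surface measure on a face is the Lebesgue measure of `ℝⁿ` in
the chart. If `n = 1` the faces are segments. If `n = 2` they are planar polygons and `edges f` is
the set of their edges, as pairs of endpoints in the chart; for `n = 1` the field `edges` plays no
role. Hanging nodes and faces that are coplanar with a neighbour are allowed. -/
structure PolyMesh (n : ℕ) (Ω : Set (E (n + 1))) where
  numElem : ℕ
  numFace : ℕ
  /-- the elements `K` -/
  elem : Fin numElem → Set (E (n + 1))
  chart : Fin numFace → (E n →ᵃⁱ[ℝ] E (n + 1))
  dom : Fin numFace → Set (E n)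
  edges : Fin numFace → Finset (E n × E n)
  /-- the set `𝓕_K` of the faces lying on `∂K` -/
  facesOf : Fin numElem → Finset (Fin numFace)
  /-- the outer unit normal to the element `K` on its face `f` -/
  normal : Fin numElem → Fin numFace → E (n + 1)
  domain : IsBoundedDomain Ω
  elem_domain : ∀ K, IsBoundedDomain (elem K)
  elem_disjoint : Pairwise fun K K' => Disjoint (elem K) (elem K')
  cover : ⋃ K, closure (elem K) = closure Ω
  dom_domain : ∀ f, IsBoundedDomain (dom f)
  edges_cover : n = 2 → ∀ f, frontier (dom f) = ⋃ e ∈ edges f, segment ℝ e.1 e.2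
  edges_ne : n = 2 → ∀ f, ∀ e ∈ edges f, e.1 ≠ e.2
  edges_disjoint : n = 2 → ∀ f, ∀ e ∈ edges f, ∀ e' ∈ edges f, e ≠ e' →
    Disjoint (openSegment ℝ e.1 e.2) (openSegment ℝ e'.1 e'.2)
  face_disjoint : Pairwise fun f f' => Disjoint (chart f '' dom f) (chart f' '' dom f')
  face_used : ∀ f, ∃ K, f ∈ facesOf K
  frontier_elem : ∀ K, frontier (elem K) = ⋃ f ∈ facesOf K, chart f '' closure (dom f)
  face_position : ∀ f, chart f '' dom f ⊆ frontier Ω ∨ chart f '' dom f ⊆ Ω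
  bdry_owner : ∀ f, chart f '' dom f ⊆ frontier Ω → ∃! K, f ∈ facesOf K
  normal_norm : ∀ K, ∀ f ∈ facesOf K, ‖normal K f‖ = 1
  normal_orth : ∀ K, ∀ f ∈ facesOf K, ∀ x y : E n,
    inner ℝ (normal K f) (chart f x - chart f y) = 0
  normal_outer : ∀ K, ∀ f ∈ facesOf K, ∀ x ∈ dom f, ∃ ε > 0, ∀ t : ℝ, 0 < t → t < ε →
    chart f x - t • normal K f ∈ elem K ∧ chart f x + t • normal K f ∉ elem K

namespace PolyMesh

variable {n : ℕ} {Ω : Set (E (n + 1))} (T : PolyMesh n Ω)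

/-- The diameter `h_K`. -/
def hK (K : Fin T.numElem) : ℝ := Metric.diam (T.elem K)

/-- `𝓕^∂ ∩ 𝓕_K`: the faces of `K` that lie on `Γ = ∂Ω`. Every face on `Γ` belongs to exactly one
element, so a sum over `𝓕^∂` is a sum over `K` and `f ∈ 𝓕^∂ ∩ 𝓕_K`, where `h̃_f = h_K`. -/
def bdryFacesOf (K : Fin T.numElem) : Finset (Fin T.numFace) :=
  (T.facesOf K).filter fun f => T.chart f '' T.dom f ⊆ frontier Ω

/-- The shape regularity assumption with the constants `γ₀`, `N₀`. -/
def ShapeRegular (γ₀ : ℝ) (N₀ : ℕ) : Prop :=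
  ∀ K,
    (∃ x ρ, γ₀ * T.hK K ≤ ρ ∧ ∀ y ∈ Metric.ball x ρ, StarConvex ℝ y (T.elem K)) ∧
    (T.facesOf K).card ≤ N₀ ∧
    (n = 2 → ∀ f ∈ T.facesOf K,
      (∃ x ρ, γ₀ * Metric.diam (T.dom f) ≤ ρ ∧
        ∀ y ∈ Metric.ball x ρ, StarConvex ℝ y (T.dom f)) ∧
      (T.edges f).card ≤ N₀)

/-- `∫_f w` for a function `w` on `ℝ^{n+1}`. -/
def faceInt (f : Fin T.numFace) (w : E (n + 1) → ℝ) : ℝ :=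
  ∫ x in T.dom f, w (T.chart f x)

/-- `∫_{∂K} w`. -/
def bdryInt (K : Fin T.numElem) (w : E (n + 1) → ℝ) : ℝ := ∑ f ∈ T.facesOf K, T.faceInt f w

/-- The polynomial trace inequality
`‖p‖_{0,∂K} ≤ C h_K^{-1/2} ‖p‖_{0,K}` for all `K` and all `p ∈ ℙ_k(K)`. -/
def InverseTrace (k : ℕ) (C : ℝ) : Prop :=
  ∀ K, ∀ p ∈ P (n + 1) k,
    √(T.bdryInt K fun x => p x ^ 2) ≤
      C * (T.hK K) ^ (-(1 / 2) : ℝ) * √(∫ x in T.elem K, p x ^ 2)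

/-- `g` is the trace on `∂K` of `u ∈ H¹(K)`: some sequence of smooth functions converges to `u` in
`H¹(K)` while its restrictions to `∂K` converge to `g` in `L²(∂K)`. -/
def HasTrace (K : Fin T.numElem) (u g : E (n + 1) → ℝ) : Prop :=
  MemH1 (T.elem K) u ∧
  (∀ f ∈ T.facesOf K, MemLp (fun x => g (T.chart f x)) 2 (volume.restrict (T.dom f))) ∧
  ∃ φ : ℕ → E (n + 1) → ℝ,
    (∀ j, ContDiff ℝ (⊤ : ℕ∞) (φ j)) ∧
    Tendsto (fun j => eLpNorm (fun x => φ j x - u x) 2 (volume.restrict (T.elem K)))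
      atTop (𝓝 0) ∧
    Tendsto (fun j => eLpNorm (fun x => gradient (φ j) x - wgrad (T.elem K) u x) 2
      (volume.restrict (T.elem K))) atTop (𝓝 0) ∧
    ∀ f ∈ T.facesOf K,
      Tendsto (fun j => eLpNorm (fun x => φ j (T.chart f x) - g (T.chart f x)) 2
        (volume.restrict (T.dom f))) atTop (𝓝 0)

/-- The trace of `u` on `∂K` (unique almost everywhere on `∂K`). -/
def trace (K : Fin T.numElem) (u : E (n + 1) → ℝ) : E (n + 1) → ℝ :=
  if h : ∃ g, T.HasTrace K u g then h.choose else 0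

/-- `p = Π^{∇,k}_K u`, the `H¹` type projection of `u ∈ H¹(K)` onto `ℙ_k(K)`. -/
def IsPiNabla (k : ℕ) (K : Fin T.numElem) (u p : E (n + 1) → ℝ) : Prop :=
  IsGradProj (T.elem K) k u p ∧ ∃ g, T.HasTrace K u g ∧ T.bdryInt K p = T.bdryInt K g

/-- The projection `Π^{∇,k}_K`. -/
def piNabla (k : ℕ) (K : Fin T.numElem) (u : E (n + 1) → ℝ) : E (n + 1) → ℝ :=
  if h : ∃ p, T.IsPiNabla k K u p then h.choose else 0

/-! ### The virtual element space -/

/-- `∫_{∂f} w` for a polygonal face `f` and a function `w` in the chart of `f`. -/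
def edgeInt (f : Fin T.numFace) (w : E n → ℝ) : ℝ :=
  ∑ e ∈ T.edges f, dist e.1 e.2 * ∫ t in (0 : ℝ)..1, w (AffineMap.lineMap e.1 e.2 t)

/-- `p = Π^{∇,k}_f w` for a polygonal face `f`. -/
def IsPiNablaFace (k : ℕ) (f : Fin T.numFace) (w p : E n → ℝ) : Prop :=
  IsGradProj (T.dom f) k w p ∧ T.edgeInt f p = T.edgeInt f w

/-- On each face `f` (in its chart), `M' f ⊆ M f` are bases of `ℙ_{k-2}(f)` and of `ℙ_k(f)`. -/
def IsFaceBases (k : ℕ) (M' M : Fin T.numFace → Set (E n → ℝ)) : Prop :=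
  ∀ f, M' f ⊆ M f ∧
    LinearIndependent ℝ (Subtype.val : M f → (E n → ℝ)) ∧
    Submodule.span ℝ (M f) = P n k ∧ Submodule.span ℝ (M' f) = P n ((k : ℤ) - 2)

/-- The local face space `V^f_k`, in the chart of `f`. If `n = 1` it is `ℙ_k(f)`. If `n = 2` it
consists of the functions that are continuous on the closed polygon `f`, lie in `H¹(f)`, are
polynomials of degree at most `k` on each edge, have their Laplacian in `ℙ_k(f)`, and satisfy
`∫_f q w = ∫_f q Π^{∇,k}_f w` for `q ∈ M f \ M' f`. -/
def faceSpace (k : ℕ) (M' M : Fin T.numFace → Set (E n → ℝ)) (f : Fin T.numFace) :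
    Set (E n → ℝ) :=
  {w | (n = 1 → ∃ p ∈ P n k, Set.EqOn w p (closure (T.dom f))) ∧
    (n = 2 →
      ContinuousOn w (closure (T.dom f)) ∧ MemH1 (T.dom f) w ∧
      (∀ e ∈ T.edges f, ∃ p ∈ P n k, Set.EqOn w p (segment ℝ e.1 e.2)) ∧
      (∃ r ∈ P n k, HasWeakLaplacian (T.dom f) w r) ∧
      ∃ p, T.IsPiNablaFace k f w p ∧
        ∀ q ∈ M f \ M' f, ∫ x in T.dom f, q x * w x = ∫ x in T.dom f, q x * p x)}

/-- The local boundary space `𝔹_k(∂K)`. -/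
def bdrySpace (k : ℕ) (M' M : Fin T.numFace → Set (E n → ℝ)) (K : Fin T.numElem) :
    Set (E (n + 1) → ℝ) :=
  {g | ContinuousOn g (frontier (T.elem K)) ∧
    ∀ f ∈ T.facesOf K, (fun x => g (T.chart f x)) ∈ T.faceSpace k M' M f}

/-- The local element space `V^K_k`: functions of `H¹(K)` with trace in `𝔹_k(∂K)` and Laplacian in
`ℙ_{k-2}(K)`. -/
def elemSpace (k : ℕ) (M' M : Fin T.numFace → Set (E n → ℝ)) (K : Fin T.numElem) :
    Set (E (n + 1) → ℝ) :=
  {v | MemH1 (T.elem K) v ∧ (∃ g ∈ T.bdrySpace k M' M K, T.HasTrace K v g) ∧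
    ∃ r ∈ P (n + 1) ((k : ℤ) - 2), HasWeakLaplacian (T.elem K) v r}

/-- The global virtual element space `V_h`. -/
def Vh (k : ℕ) (M' M : Fin T.numFace → Set (E n → ℝ)) : Set (E (n + 1) → ℝ) :=
  {v | MemH1 Ω v ∧ ∀ K, v ∈ T.elemSpace k M' M K}

/-- The multiplier space `Λ_h = ℙ_{k'}(𝓕^∂)`; only the values on the (relatively open) boundary
faces matter. -/
def Lh (k' : ℕ) : Set (E (n + 1) → ℝ) :=
  {μ | ∀ K, ∀ f ∈ T.bdryFacesOf K,
    ∃ p ∈ P n k', Set.EqOn (fun x => μ (T.chart f x)) p (T.dom f)}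

/-! ### The bilinear form and the norms -/

/-- `S` is an admissible stabilization: on each `V^K_k` the form `S K` is symmetric, and it
satisfies `c_* a^K(φ,φ) ≤ S K φ φ ≤ C^* a^K(φ,φ)` for all `φ ∈ V^K_k` with `Π^∇ φ = 0`. -/
def IsStabilization (k : ℕ) (M' M : Fin T.numFace → Set (E n → ℝ)) (cLow cUp : ℝ)
    (S : Fin T.numElem → LinearMap.BilinForm ℝ (E (n + 1) → ℝ)) : Prop :=
  ∀ K,
    (∀ φ ∈ T.elemSpace k M' M K, ∀ ψ ∈ T.elemSpace k M' M K, S K φ ψ = S K ψ φ) ∧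
    ∀ φ ∈ T.elemSpace k M' M K, T.IsPiNabla k K φ 0 →
      cLow * dirichlet (T.elem K) φ φ ≤ S K φ φ ∧ S K φ φ ≤ cUp * dirichlet (T.elem K) φ φ

/-- The elemental form `a_h^K`. -/
def ahK (k : ℕ) (S : Fin T.numElem → LinearMap.BilinForm ℝ (E (n + 1) → ℝ))
    (K : Fin T.numElem) (φ ψ : E (n + 1) → ℝ) : ℝ :=
  dirichlet (T.elem K) (T.piNabla k K φ) (T.piNabla k K ψ) +
    S K (φ - T.piNabla k K φ) (ψ - T.piNabla k K ψ)

/-- The approximate bilinear form `a_h = ∑_K a_h^K`. -/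
def ah (k : ℕ) (S : Fin T.numElem → LinearMap.BilinForm ℝ (E (n + 1) → ℝ))
    (φ ψ : E (n + 1) → ℝ) : ℝ := ∑ K, T.ahK k S K φ ψ

/-- `∂_ν Π^∇(u)` on the face `f` of `K`. -/
def dnPi (k : ℕ) (K : Fin T.numElem) (f : Fin T.numFace) (u : E (n + 1) → ℝ) :
    E (n + 1) → ℝ :=
  fun x => inner ℝ (gradient (T.piNabla k K u) x) (T.normal K f)

/-- `∫_Γ μ v` for a function `μ` on `Γ` and (the trace of) `v ∈ V_h`. -/
def pairing (μ v : E (n + 1) → ℝ) : ℝ :=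
  ∑ K, ∑ f ∈ T.bdryFacesOf K, T.faceInt f fun x => μ x * T.trace K v x

/-- The stabilized Barbosa–Hughes form `𝔞_h^{BH}(u, l; v, μ)`. -/
def aBH (k : ℕ) (S : Fin T.numElem → LinearMap.BilinForm ℝ (E (n + 1) → ℝ)) (α : ℝ)
    (u l v μ : E (n + 1) → ℝ) : ℝ :=
  T.ah k S u v + T.pairing l v + T.pairing μ u -
    α * ∑ K, ∑ f ∈ T.bdryFacesOf K,
      T.hK K * T.faceInt f fun x => (l x + T.dnPi k K f u x) * (μ x + T.dnPi k K f v x)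

/-- `‖μ‖_{-1/2,h}`. -/
def normMinus (μ : E (n + 1) → ℝ) : ℝ :=
  √(∑ K, ∑ f ∈ T.bdryFacesOf K, T.hK K * T.faceInt f fun x => μ x ^ 2)

/-- `‖u‖_{1,h}`, where `‖u‖²_{1,h} = ∑_K |u|²_{1,K} + ‖Π⁰_∂ u‖²_{1/2,h}` and `Π⁰_∂` is, on each
boundary face `f`, the `L²(f)` projection of the trace onto `ℙ_{k'}(f)`. -/
def norm1h (k' : ℕ) (u : E (n + 1) → ℝ) : ℝ :=
  √((∑ K, ∫ x in T.elem K, ‖wgrad (T.elem K) u x‖ ^ 2) +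
    ∑ K, ∑ f ∈ T.bdryFacesOf K,
      (T.hK K)⁻¹ * ∫ x in T.dom f,
        (l2Proj (T.dom f) k' (fun y => T.trace K u (T.chart f y)) x) ^ 2)

/-- The norm `‖v‖_{1,h} + ‖μ‖_{-1/2,h}` of a pair. -/
def normBH (k' : ℕ) (v μ : E (n + 1) → ℝ) : ℝ := T.norm1h k' v + T.normMinus μ

end PolyMesh

end BHVEM

end

noncomputable section

open MeasureTheory Filter Topology
open scoped Classical

namespace BHVEM

/-! ### Polynomial functions -/

/-! The inverse trace inequality rests on finite dimensionality and scaling. On `P n j` the L² norm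
over a fixed ball controls the supremum over the unit ball, because a polynomial vanishing on a
nonempty open set is zero. Rescaled, this bounds p² on the closure of K by a multiple of
h_K^{-(n+1)} ∫_K p², since K contains a ball of radius γ₀ h_K and lies within distance h_K of its
centre. Each face has measure at most a constant times h_K^n and there are at most N₀ faces, which
gives `exists_inverseTrace`.

For the form, write (w, z) for `bdryForm`, the sum of h_K ∫_f w z over boundary faces; q = h_K⁻¹
Π⁰_∂ u and ν = ∂_ν Π^∇ u on the faces. Multipliers are polynomials of degree ≤ k' on each face, so
∫_Γ λ u = (λ, q) (`pairing_eq`). Moreover ‖λ‖² = (λ, λ), and ‖u‖² is the broken Dirichlet energy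
plus (q, q). Let A be the energy of Π^∇ u and B that of u - Π^∇ u; the energy of u is A + B. The
inverse inequality applied to the components of ∇Π^∇ u gives (ν, ν) ≤ C² A
(`bdryForm_normalFamily_le`). Continuity is then Cauchy–Schwarz term by term; for the stabilization
it is used on the kernel of Π^∇, where that form is nonnegative.

For the inf-sup bound, test with (u, -λ + q/4). The pairings (λ, q) cancel, as do the products of λ
with ν, leaving a_h(u,u) + (q,q)/4 + α(λ,λ) - α(ν,ν) - (α/4)((λ,q) + (ν,q)). Here a_h(u,u) ≥ A + c_*
B, and α C_inv² ≤ 2/3 gives α(ν,ν) ≤ 2A/3. Young's inequality absorbs the mixed terms and leaves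
positive multiples of A, B, (q,q) and (λ,λ) (`stability_estimate`, `exists_test_multiplier`). Since
ν sees only Π^∇ u, whose energy enters a_h with coefficient one, the threshold on α does not involve
c_* or C^*. -/

theorem polyEval_apply {n : ℕ} (q : MvPolynomial (Fin n) ℝ) (x : E n) :
    polyEval n q x = MvPolynomial.eval (fun i => x i) q := by
  simp [polyEval, MvPolynomial.aeval_eq_eval]

/-- Reduces closure properties to monomials and, as there are finitely many of bounded degree,
yields finite dimension. -/
theorem P_eq_span (n : ℕ) (j : ℤ) :
    P n j = Submodule.span ℝ
      ((fun (s : Fin n →₀ ℕ) (x : E n) => ∏ i, x i ^ s i) '' {s | (s.degree : ℤ) ≤ j}) := by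
  rw [P, MvPolynomial.restrictSupport_eq_span, Submodule.map_span, ← Set.image_comp]
  congr 1
  apply Set.image_congr
  intro s _
  ext x
  simp [polyEval_apply, MvPolynomial.eval_monomial, Finsupp.prod_fintype]

theorem finite_degree_le (n : ℕ) (j : ℤ) : {s : Fin n →₀ ℕ | (s.degree : ℤ) ≤ j}.Finite := by
  refine (Finsupp.finite_of_degree_le (σ := Fin n) j.toNat).subset fun s hs => ?_
  simp only [Set.mem_ofPred_eq] at hs ⊢
  omega

instance (n : ℕ) (j : ℤ) : FiniteDimensional ℝ (P n j) := by
  rw [P_eq_span]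
  exact FiniteDimensional.span_of_finite ℝ ((finite_degree_le n j).image _)

theorem P_mono (n : ℕ) {i j : ℤ} (h : i ≤ j) : P n i ≤ P n j :=
  Submodule.map_mono (MvPolynomial.restrictSupport_mono ℝ fun _ hs => le_trans hs h)

theorem const_mem_P (n : ℕ) {j : ℤ} (hj : 0 ≤ j) (c : ℝ) : (fun _ : E n => c) ∈ P n j := by
  refine ⟨MvPolynomial.C c, ?_, ?_⟩
  · rw [MvPolynomial.C_apply]
    exact (MvPolynomial.monomial_mem_restrictSupport ℝ).2 (Or.inl (by simpa using hj))
  · ext x; simp [polyEval_apply]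

theorem mul_mem_P {n : ℕ} {i j : ℤ} {p q : E n → ℝ} (hp : p ∈ P n i) (hq : q ∈ P n j) :
    (fun x => p x * q x) ∈ P n (i + j) := by
  obtain ⟨p, hp, rfl⟩ := hp
  obtain ⟨q, hq, rfl⟩ := hq
  refine ⟨p * q, ?_, ?_⟩
  · have : p * q ∈ MvPolynomial.restrictSupport ℝ {s : Fin n →₀ ℕ | (s.degree : ℤ) ≤ i} *
      MvPolynomial.restrictSupport ℝ {s : Fin n →₀ ℕ | (s.degree : ℤ) ≤ j} :=
      Submodule.mul_mem_mul hp hq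
    rw [← MvPolynomial.restrictSupport_add] at this
    refine MvPolynomial.restrictSupport_mono ℝ ?_ this
    rintro _ ⟨s, hs, t, ht, rfl⟩
    simp only [Set.mem_ofPred_eq, map_add, Nat.cast_add] at *
    omega
  · ext x; simp [polyEval_apply]

theorem prod_pow_mem_P {m : ℕ} {ι : Type*} (t : Finset ι) (s : ι → ℕ) (g : ι → E m → ℝ)
    (hg : ∀ i ∈ t, g i ∈ P m 1) :
    (fun x => ∏ i ∈ t, g i x ^ s i) ∈ P m (∑ i ∈ t, (s i : ℤ)) := by
  have hpow : ∀ i ∈ t, ∀ a : ℕ, (fun x => g i x ^ a) ∈ P m a := by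
    intro i hi a
    induction a with
    | zero => simpa using const_mem_P m le_rfl 1
    | succ a ih => simpa [pow_succ] using mul_mem_P ih (hg i hi)
  induction t using Finset.induction_on with
  | empty => simpa using const_mem_P m le_rfl 1
  | insert a t ha ih =>
    simp only [Finset.prod_insert ha, Finset.sum_insert ha]
    exact mul_mem_P (hpow a (Finset.mem_insert_self a t) _)
      (ih (fun i hi => hg i (Finset.mem_insert_of_mem hi))
        fun i hi => hpow i (Finset.mem_insert_of_mem hi))

theorem coord_mem_P {n : ℕ} (i : Fin n) : (fun x : E n => x i) ∈ P n 1 := by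
  refine ⟨MvPolynomial.X i, ?_, ?_⟩
  · exact (MvPolynomial.monomial_mem_restrictSupport ℝ).2 (Or.inl (by simp))
  · ext x; simp [polyEval_apply]

theorem linear_mem_P {m : ℕ} (L : E m →ₗ[ℝ] ℝ) : (fun x => L x) ∈ P m 1 := by
  have : (fun x => L x) = ∑ i, L (EuclideanSpace.single i 1) • (fun x : E m => x i) := by
    ext x
    conv_lhs => rw [← (EuclideanSpace.basisFun (Fin m) ℝ).sum_repr x]
    simp [mul_comm]
  rw [this]
  exact Submodule.sum_mem _ fun i _ => Submodule.smul_mem _ _ (coord_mem_P i)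

/-- A monomial composed with an affine map is a product of factors of degree at most one. This
serves both for restricting polynomials to faces through the charts and for rescaling to a reference
ball. -/
theorem comp_affine_mem_P {m n : ℕ} {j : ℤ} {p : E n → ℝ} (hp : p ∈ P n j)
    (A : E m →ᵃ[ℝ] E n) : (fun x => p (A x)) ∈ P m j := by
  suffices P n j ≤ (P m j).comap (LinearMap.funLeft ℝ ℝ A) from this hp
  rw [P_eq_span n j, Submodule.span_le]
  rintro _ ⟨s, hs, rfl⟩
  have hA : ∀ i ∈ (Finset.univ : Finset (Fin n)), (fun x => A x i) ∈ P m 1 := by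
    intro i _
    have : (fun x => A x i) = (fun x => ((EuclideanSpace.proj i : E n →L[ℝ] ℝ).toLinearMap ∘ₗ
        A.linear) x) + fun _ => A 0 i := by
      ext x
      have := congrFun A.decomp x
      simp [this]
    rw [this]
    exact Submodule.add_mem _ (linear_mem_P _) (const_mem_P m zero_le_one _)
  refine P_mono m ?_ (prod_pow_mem_P Finset.univ s (fun i x => A x i) hA)
  refine le_trans (le_of_eq ?_) hs
  rw [Finsupp.degree_eq_sum]
  simp

theorem contDiff_polyEval {n : ℕ} (q : MvPolynomial (Fin n) ℝ) {N : WithTop ℕ∞} :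
    ContDiff ℝ N (polyEval n q) := by
  have : polyEval n q = fun x => polyEval n q x := rfl
  rw [this]
  clear this
  simp_rw [polyEval_apply]
  induction q using MvPolynomial.induction_on with
  | C a => simpa using contDiff_const
  | add p q hp hq => simpa using hp.add hq
  | mul_X p i hp =>
    simp only [map_mul, MvPolynomial.eval_X]
    exact hp.mul (EuclideanSpace.proj i : E n →L[ℝ] ℝ).contDiff

theorem contDiff_of_mem_P {n : ℕ} {j : ℤ} {p : E n → ℝ} (hp : p ∈ P n j) {N : WithTop ℕ∞} :
    ContDiff ℝ N p := by
  obtain ⟨q, -, rfl⟩ := hp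
  exact contDiff_polyEval q

theorem continuous_of_mem_P {n : ℕ} {j : ℤ} {p : E n → ℝ} (hp : p ∈ P n j) : Continuous p :=
  (contDiff_of_mem_P (N := 0) hp).continuous

theorem gradient_apply {n : ℕ} (f : E n → ℝ) (x : E n) (i : Fin n) :
    gradient f x i = fderiv ℝ f x (EuclideanSpace.single i 1) := by
  have h : inner ℝ (gradient f x) (EuclideanSpace.single i (1 : ℝ)) =
      fderiv ℝ f x (EuclideanSpace.single i 1) := by
    rw [gradient, InnerProductSpace.toDual_symm_apply]
  rw [← h, EuclideanSpace.inner_single_right]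
  simp

theorem gradient_polyEval {n : ℕ} (q : MvPolynomial (Fin n) ℝ) (i : Fin n) (x : E n) :
    gradient (polyEval n q) x i = polyEval n (MvPolynomial.pderiv i q) x := by
  rw [gradient_apply]
  have hd : ∀ q x, DifferentiableAt ℝ (polyEval n q) x := fun q x =>
    (contDiff_polyEval q (N := 1)).differentiable one_ne_zero x
  induction q using MvPolynomial.induction_on generalizing x with
  | C a =>
    have : polyEval n (MvPolynomial.C a) = fun _ => a := by ext x; simp [polyEval_apply]
    simp [this]
  | add p q hp hq =>
    rw [map_add, fderiv_add (hd _ _) (hd _ _)]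
    simp [hp, hq]
  | mul_X p j hp =>
    have h1 : polyEval n (p * MvPolynomial.X j) = fun x => polyEval n p x *
        (EuclideanSpace.proj j : E n →L[ℝ] ℝ) x := by
      ext x; simp [polyEval_apply]
    rw [h1, fderiv_fun_mul (hd _ _) (ContinuousLinearMap.differentiableAt _)]
    rw [ContinuousLinearMap.fderiv]
    simp only [add_apply, smul_apply, hp,
      Derivation.leibniz, map_add, Pi.add_apply, smul_eq_mul, MvPolynomial.pderiv_X,
      PiLp.proj_apply, PiLp.single_apply]
    by_cases h : i = j
    · subst h; simp [polyEval_apply]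
    · simp [polyEval_apply, Ne.symm h]

theorem gradient_mem_P {n : ℕ} {j : ℤ} {p : E n → ℝ} (hp : p ∈ P n j) (i : Fin n) :
    (fun x => gradient p x i) ∈ P n (j - 1) := by
  obtain ⟨q, hq, rfl⟩ := hp
  refine ⟨MvPolynomial.pderiv i q, ?_, by ext x; rw [gradient_polyEval]⟩
  suffices MvPolynomial.restrictSupport ℝ {s : Fin n →₀ ℕ | (s.degree : ℤ) ≤ j} ≤
    (MvPolynomial.restrictSupport ℝ {s : Fin n →₀ ℕ | (s.degree : ℤ) ≤ j - 1}).comap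
      (MvPolynomial.pderiv i).toLinearMap from this hq
  rw [MvPolynomial.restrictSupport_eq_span, Submodule.span_le]
  rintro _ ⟨s, hs, rfl⟩
  simp only [Submodule.comap_coe, Set.mem_preimage, SetLike.mem_coe,
    Derivation.coeFn_coe, MvPolynomial.pderiv_monomial]
  refine (MvPolynomial.monomial_mem_restrictSupport ℝ).2 ?_
  -- If the variable is absent the derivative has coefficient zero; otherwise the truncated
  -- subtraction of exponents is exact and the degree drops by one.
  by_cases h : s i = 0
  · right; simp [h]
  · left
    simp only [Set.mem_ofPred_eq] at hs ⊢
    have h2 : (s - Finsupp.single i 1) + Finsupp.single i 1 = s :=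
      tsub_add_cancel_of_le (Finsupp.single_le_iff.2 (by omega))
    have h3 := congrArg Finsupp.degree h2
    rw [map_add, Finsupp.degree_single] at h3
    omega

theorem continuous_gradient_of_mem_P {n : ℕ} {j : ℤ} {p : E n → ℝ} (hp : p ∈ P n j) :
    Continuous (gradient p) := by
  have : gradient p = fun x => WithLp.toLp 2 fun i => gradient p x i := rfl
  rw [this]
  exact (PiLp.continuous_toLp 2 _).comp
    (continuous_pi fun i => continuous_of_mem_P (gradient_mem_P hp i))

/-- Identity theorem for analytic functions. It makes the L² seminorm over any ball of positive
radius a norm on polynomials. -/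
theorem eq_zero_of_eqOn_open {n : ℕ} {j : ℤ} {p : E n → ℝ} (hp : p ∈ P n j) {U : Set (E n)}
    (hU : IsOpen U) (hne : U.Nonempty) (h : ∀ x ∈ U, p x = 0) : p = 0 := by
  have ha : AnalyticOnNhd ℝ p Set.univ := fun x _ =>
    ((contDiff_of_mem_P (N := ⊤) hp).contDiffAt (x := x)).analyticAt
  obtain ⟨x, hx⟩ := hne
  exact ha.eq_of_eventuallyEq (g := 0) (fun x _ => analyticAt_const)
    (Filter.eventually_of_mem (hU.mem_nhds hx) h)

/-- Linearity is carried throughout in the single form `u + c • v`, which covers sums, differences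
(`c = -1`) and scalar multiples (`u = 0`). -/
theorem gradient_add_smul {n : ℕ} {f g : E n → ℝ} {x : E n} (hf : DifferentiableAt ℝ f x)
    (hg : DifferentiableAt ℝ g x) (c : ℝ) :
    gradient (f + c • g) x = gradient f x + c • gradient g x := by
  rw [gradient, fderiv_add hf (hg.const_smul c), fderiv_const_smul hg]
  simp [gradient]

theorem differentiable_of_mem_P {n : ℕ} {j : ℤ} {p : E n → ℝ} (hp : p ∈ P n j) :
    Differentiable ℝ p :=
  (contDiff_of_mem_P (N := 1) hp).differentiable one_ne_zero

/-! ### Weak gradients and orthogonal projections -/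

theorem memLp_of_continuous_of_isBounded {n : ℕ} {F : Type*} [NormedAddCommGroup F] {D : Set (E n)}
    (hD : Bornology.IsBounded D) {f : E n → F} (hf : Continuous f) {p : ENNReal} :
    MemLp f p (volume.restrict D) := by
  have hK : IsCompact (closure D) := hD.isCompact_closure
  have h : MemLp f p (volume.restrict (closure D)) := by
    have : IsFiniteMeasure (volume.restrict (closure D)) := ⟨by
      rw [Measure.restrict_apply_univ]; exact hK.measure_lt_top⟩
    obtain ⟨C, hC⟩ := hK.exists_bound_of_continuousOn hf.continuousOn
    exact MemLp.of_bound hf.aestronglyMeasurable C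
      (ae_restrict_of_forall_mem isClosed_closure.measurableSet hC)
  exact h.mono_measure (Measure.restrict_mono subset_closure le_rfl)

theorem integrableOn_of_memLp_two {n : ℕ} {D : Set (E n)} (hD : Bornology.IsBounded D)
    {f : E n → ℝ} (hf : MemLp f 2 (volume.restrict D)) : Integrable f (volume.restrict D) := by
  have : IsFiniteMeasure (volume.restrict D) := ⟨by
    rw [Measure.restrict_apply_univ]; exact hD.measure_lt_top⟩
  exact hf.integrable one_le_two

theorem continuous_gradient {n : ℕ} {φ : E n → ℝ} (hφ : ContDiff ℝ 1 φ) :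
    Continuous (gradient φ) :=
  (InnerProductSpace.toDual ℝ (E n)).symm.continuous.comp (hφ.continuous_fderiv one_ne_zero)

theorem hasCompactSupport_gradient {n : ℕ} {φ : E n → ℝ} (hφ : HasCompactSupport φ) :
    HasCompactSupport (gradient φ) :=
  (hφ.fderiv (𝕜 := ℝ)).comp_left (map_zero _)

theorem gradient_eq_zero_of_notMem_tsupport {n : ℕ} {φ : E n → ℝ} {x : E n}
    (hx : x ∉ tsupport φ) : gradient φ x = 0 := by
  have h : fderiv ℝ φ x = 0 := by
    by_contra hne
    exact hx (tsupport_fderiv_subset ℝ (subset_tsupport _ hne))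
  simp [gradient, h]

/-- Integration by parts of a smooth function against a test function. -/
theorem setIntegral_mul_gradient {n : ℕ} {D : Set (E n)} {p φ : E n → ℝ} (hp : ContDiff ℝ 1 p)
    (hφ : ContDiff ℝ 1 φ) (hc : HasCompactSupport φ) (hs : tsupport φ ⊆ D) (i : Fin n) :
    ∫ x in D, p x * gradient φ x i = - ∫ x in D, φ x * gradient p x i := by
  have hpg : Continuous fun x => gradient p x i :=
    (EuclideanSpace.proj i : E n →L[ℝ] ℝ).continuous.comp (continuous_gradient hp)
  have hφg : Continuous fun x => gradient φ x i :=
    (EuclideanSpace.proj i : E n →L[ℝ] ℝ).continuous.comp (continuous_gradient hφ)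
  have hcg : HasCompactSupport fun x => gradient φ x i :=
    (hasCompactSupport_gradient hc).comp_left (g := fun y : E n => y i) rfl
  rw [setIntegral_eq_integral_of_forall_compl_eq_zero, setIntegral_eq_integral_of_forall_compl_eq_zero]
  · simp_rw [gradient_apply] at *
    rw [integral_mul_fderiv_eq_neg_fderiv_mul_of_integrable]
    · simp_rw [mul_comm]
    · exact (hpg.mul hφ.continuous).integrable_of_hasCompactSupport hc.mul_left
    · exact (hp.continuous.mul hφg).integrable_of_hasCompactSupport hcg.mul_left
    · exact (hp.continuous.mul hφ.continuous).integrable_of_hasCompactSupport hc.mul_left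
    · exact fun x _ => hp.differentiable one_ne_zero x
    · exact fun x _ => hφ.differentiable one_ne_zero x
  · intro x hx
    rw [image_eq_zero_of_notMem_tsupport fun h => hx (hs h), zero_mul]
  · intro x hx
    rw [gradient_eq_zero_of_notMem_tsupport fun h => hx (hs h)]
    simp

section WeakGradient

variable {n : ℕ} {D : Set (E n)}

theorem isWeakGrad_of_contDiff (hD : Bornology.IsBounded D) {p : E n → ℝ} (hp : ContDiff ℝ 1 p) :
    IsWeakGrad D p (gradient p) := by
  refine ⟨memLp_of_continuous_of_isBounded hD hp.continuous,
    memLp_of_continuous_of_isBounded hD (continuous_gradient hp), fun φ hφ hc hs => ?_⟩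
  have hφ1 : ContDiff ℝ 1 φ := hφ.of_le (by exact_mod_cast le_top)
  have h1 : Integrable (fun x => p x • gradient φ x) (volume.restrict D) :=
    ((hp.continuous.smul (continuous_gradient hφ1)).integrable_of_hasCompactSupport
      (hasCompactSupport_gradient hc).smul_left).integrableOn
  have h2 : Integrable (fun x => φ x • gradient p x) (volume.restrict D) :=
    ((hφ.continuous.smul (continuous_gradient hp)).integrable_of_hasCompactSupport
      hc.smul_right).integrableOn
  ext i
  have e1 := (EuclideanSpace.proj i : E n →L[ℝ] ℝ).integral_comp_comm h1
  have e2 := (EuclideanSpace.proj i : E n →L[ℝ] ℝ).integral_comp_comm h2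
  simp only [PiLp.proj_apply, PiLp.smul_apply, smul_eq_mul] at e1 e2
  rw [PiLp.neg_apply, ← e1, ← e2]
  exact setIntegral_mul_gradient hp hφ1 hc hs i

theorem integrable_smul_gradient {u : E n → ℝ} (hu : MemLp u 2 (volume.restrict D))
    {φ : E n → ℝ} (hφ : ContDiff ℝ (⊤ : ℕ∞) φ) (hc : HasCompactSupport φ) :
    Integrable (fun x => u x • gradient φ x) (volume.restrict D) := by
  have hφ1 : ContDiff ℝ 1 φ := hφ.of_le (by exact_mod_cast le_top)
  have h : MemLp (gradient φ) 2 (volume.restrict D) :=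
    ((continuous_gradient hφ1).memLp_of_hasCompactSupport
      (hasCompactSupport_gradient hc)).restrict D
  exact memLp_one_iff_integrable.1 (h.smul hu)

theorem integrable_smul_of_test {G : E n → E n} (hG : MemLp G 2 (volume.restrict D))
    {φ : E n → ℝ} (hφ : ContDiff ℝ (⊤ : ℕ∞) φ) (hc : HasCompactSupport φ) :
    Integrable (fun x => φ x • G x) (volume.restrict D) :=
  memLp_one_iff_integrable.1
    (hG.smul ((hφ.continuous.memLp_of_hasCompactSupport (p := 2) hc).restrict D))

theorem IsWeakGrad.add_smul {u v : E n → ℝ} {G H : E n → E n} (hu : IsWeakGrad D u G)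
    (hv : IsWeakGrad D v H) (c : ℝ) : IsWeakGrad D (u + c • v) (G + c • H) := by
  refine ⟨hu.1.add (hv.1.const_smul c), hu.2.1.add (hv.2.1.const_smul c), fun φ hφ hc hs => ?_⟩
  have e1 : ∀ x, (u + c • v) x • gradient φ x =
      u x • gradient φ x + c • (v x • gradient φ x) := by
    intro x; simp [_root_.add_smul, smul_smul]
  have e2 : ∀ x, φ x • (G + c • H) x = φ x • G x + c • (φ x • H x) := by
    intro x; simp [smul_smul, mul_comm]
  simp_rw [e1, e2]
  rw [integral_add (integrable_smul_gradient hu.1 hφ hc)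
      ((integrable_smul_gradient hv.1 hφ hc).fun_smul c),
    integral_add (integrable_smul_of_test hu.2.1 hφ hc)
      ((integrable_smul_of_test hv.2.1 hφ hc).fun_smul c),
    integral_smul, integral_smul, hu.2.2 φ hφ hc hs, hv.2.2 φ hφ hc hs]
  module

/-- The fundamental lemma of the calculus of variations applied to `G - H`. Without this uniqueness
the chosen `wgrad` would not be linear modulo null sets. -/
theorem IsWeakGrad.ae_eq (hD : IsOpen D) {u : E n → ℝ} {G H : E n → E n} (hG : IsWeakGrad D u G)
    (hH : IsWeakGrad D u H) : G =ᵐ[volume.restrict D] H := by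
  have hloc : LocallyIntegrableOn (fun x => G x - H x) D volume := by
    rw [locallyIntegrableOn_iff hD.isLocallyClosed]
    intro K hKD hK
    have h2 : MemLp (fun x => G x - H x) 2 (volume.restrict K) :=
      (hG.2.1.sub hH.2.1).mono_measure (Measure.restrict_mono hKD le_rfl)
    have : IsFiniteMeasure (volume.restrict K) := ⟨by
      rw [Measure.restrict_apply_univ]; exact hK.measure_lt_top⟩
    exact h2.integrable one_le_two
  have key := hD.ae_eq_zero_of_integral_contDiff_smul_eq_zero hloc (fun φ hφ hc hs => by
    rw [← setIntegral_eq_integral_of_forall_compl_eq_zero (s := D)]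
    · simp_rw [smul_sub]
      rw [integral_sub (integrable_smul_of_test hG.2.1 hφ hc)
        (integrable_smul_of_test hH.2.1 hφ hc)]
      have := (hG.2.2 φ hφ hc hs).symm.trans (hH.2.2 φ hφ hc hs)
      rw [neg_inj] at this
      rw [this, sub_self]
    · intro x hx
      rw [image_eq_zero_of_notMem_tsupport fun h => hx (hs h), zero_smul])
  filter_upwards [(ae_restrict_iff' hD.measurableSet).2 key] with x hx
  exact sub_eq_zero.1 hx

theorem MemH1.isWeakGrad {u : E n → ℝ} (h : MemH1 D u) : IsWeakGrad D u (wgrad D u) := by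
  rw [wgrad, dif_pos h]
  exact h.choose_spec

theorem MemH1.add_smul {u v : E n → ℝ} (hu : MemH1 D u) (hv : MemH1 D v) (c : ℝ) :
    MemH1 D (u + c • v) := ⟨_, hu.isWeakGrad.add_smul hv.isWeakGrad c⟩

theorem memLp_wgrad (D : Set (E n)) (u : E n → ℝ) :
    MemLp (wgrad D u) 2 (volume.restrict D) := by
  by_cases h : MemH1 D u
  · exact h.isWeakGrad.2.1
  · rw [wgrad, dif_neg h]; exact MemLp.zero

theorem IsWeakGrad.wgrad_ae_eq (hD : IsOpen D) {u : E n → ℝ} {G : E n → E n}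
    (h : IsWeakGrad D u G) : wgrad D u =ᵐ[volume.restrict D] G :=
  IsWeakGrad.ae_eq hD (MemH1.isWeakGrad ⟨G, h⟩) h

/-- The weak gradient as an element of `L²(D)ⁿ`. -/
def gradLp (D : Set (E n)) (u : E n → ℝ) : Lp (E n) 2 (volume.restrict D) :=
  (memLp_wgrad D u).toLp _

theorem inner_toLp {F G : E n → E n} (hF : MemLp F 2 (volume.restrict D))
    (hG : MemLp G 2 (volume.restrict D)) :
    inner ℝ (hF.toLp F) (hG.toLp G) = ∫ x in D, inner ℝ (F x) (G x) := by
  rw [L2.inner_def]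
  refine integral_congr_ae ?_
  filter_upwards [hF.coeFn_toLp, hG.coeFn_toLp] with x h1 h2
  rw [h1, h2]

/-- Moves the energy into the Hilbert space L²(D)ⁿ, where Cauchy–Schwarz, Pythagoras and orthogonal
projection are at hand. -/
theorem dirichlet_eq_inner (u v : E n → ℝ) :
    dirichlet D u v = inner ℝ (gradLp D u) (gradLp D v) :=
  (inner_toLp _ _).symm

theorem IsWeakGrad.gradLp_eq (hD : IsOpen D) {u : E n → ℝ} {G : E n → E n}
    (h : IsWeakGrad D u G) : gradLp D u = h.2.1.toLp G :=
  MemLp.toLp_congr _ _ (h.wgrad_ae_eq hD)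

theorem gradLp_add_smul (hD : IsOpen D) {u v : E n → ℝ} (hu : MemH1 D u) (hv : MemH1 D v)
    (c : ℝ) : gradLp D (u + c • v) = gradLp D u + c • gradLp D v := by
  rw [(hu.isWeakGrad.add_smul hv.isWeakGrad c).gradLp_eq hD]
  rfl

theorem isWeakGrad_of_mem_P (hD : Bornology.IsBounded D) {j : ℤ} {p : E n → ℝ} (hp : p ∈ P n j) :
    IsWeakGrad D p (gradient p) := isWeakGrad_of_contDiff hD (contDiff_of_mem_P hp)

theorem memH1_of_mem_P (hD : Bornology.IsBounded D) {j : ℤ} {p : E n → ℝ} (hp : p ∈ P n j) :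
    MemH1 D p := ⟨_, isWeakGrad_of_mem_P hD hp⟩

theorem isGradProj_iff (hD : IsOpen D) (hb : Bornology.IsBounded D) {k : ℕ} {v p : E n → ℝ} :
    IsGradProj D k v p ↔ p ∈ P n k ∧ ∀ w ∈ P n k,
      inner ℝ (gradLp D p) (gradLp D w) = inner ℝ (gradLp D v) (gradLp D w) := by
  refine and_congr_right fun hp => forall₂_congr fun w hw => ?_
  rw [(isWeakGrad_of_mem_P hb hp).gradLp_eq hD, (isWeakGrad_of_mem_P hb hw).gradLp_eq hD, gradLp,
    inner_toLp, inner_toLp]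

/-! ### Existence of the polynomial projections -/

/-- Take a preimage of the orthogonal projection of `x` onto the finite-dimensional range of `T`.
Injectivity is not needed, so the gradient map, which kills constants, is allowed. -/
theorem exists_inner_eq {V H : Type*} [AddCommGroup V] [Module ℝ V] [FiniteDimensional ℝ V]
    [NormedAddCommGroup H] [InnerProductSpace ℝ H] (T : V →ₗ[ℝ] H) (x : H) :
    ∃ v, ∀ w, inner ℝ (T v) (T w) = inner ℝ x (T w) := by
  obtain ⟨v, hv⟩ := (LinearMap.range T).starProjection_apply_mem x
  refine ⟨v, fun w => ?_⟩
  have h := (LinearMap.range T).starProjection_inner_eq_zero x (T w) ⟨w, rfl⟩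
  rw [hv, ← sub_eq_zero, ← inner_sub_left, ← neg_sub, inner_neg_left, h, neg_zero]

theorem exists_isGradProj (hD : IsOpen D) (hb : Bornology.IsBounded D) (k : ℕ) (v : E n → ℝ) :
    ∃ p, IsGradProj D k v p := by
  -- With both functions zero and `c = 1`, linearity reads g = g + g.
  have h0 : gradLp D (0 : E n → ℝ) = 0 := by
    have := gradLp_add_smul hD (memH1_of_mem_P hb (zero_mem (P n k)))
      (memH1_of_mem_P hb (zero_mem (P n k))) 1
    simpa using this
  let T : P n k →ₗ[ℝ] Lp (E n) 2 (volume.restrict D) :=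
    { toFun := fun p => gradLp D p
      map_add' := fun p q => by
        simpa using gradLp_add_smul hD (memH1_of_mem_P hb p.2) (memH1_of_mem_P hb q.2) 1
      map_smul' := fun c p => by
        simpa [h0] using gradLp_add_smul hD (memH1_of_mem_P hb (zero_mem (P n k)))
          (memH1_of_mem_P hb p.2) c }
  obtain ⟨p, hp⟩ := exists_inner_eq T (gradLp D v)
  exact ⟨p, (isGradProj_iff hD hb).2 ⟨p.2, fun w hw => hp ⟨w, hw⟩⟩⟩

theorem l2Proj_spec (hb : Bornology.IsBounded D) (j : ℤ) {w : E n → ℝ}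
    (hw : MemLp w 2 (volume.restrict D)) : IsL2Proj D j w (l2Proj D j w) := by
  have hex : ∃ p, IsL2Proj D j w p := by
    have hm : ∀ p : P n j, MemLp (p : E n → ℝ) 2 (volume.restrict D) := fun p =>
      memLp_of_continuous_of_isBounded hb (continuous_of_mem_P p.2)
    let T : P n j →ₗ[ℝ] Lp ℝ 2 (volume.restrict D) :=
      { toFun := fun p => (hm p).toLp _
        map_add' := fun p q => rfl
        map_smul' := fun c p => rfl }
    have hin : ∀ {F G : E n → ℝ} (hF : MemLp F 2 (volume.restrict D))
        (hG : MemLp G 2 (volume.restrict D)),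
        inner ℝ (hF.toLp F) (hG.toLp G) = ∫ x in D, F x * G x := by
      intro F G hF hG
      rw [L2.inner_def]
      refine integral_congr_ae ?_
      filter_upwards [hF.coeFn_toLp, hG.coeFn_toLp] with x h1 h2
      rw [h1, h2]
      simp [mul_comm]
    obtain ⟨p, hp⟩ := exists_inner_eq T (hw.toLp w)
    refine ⟨p, p.2, fun q hq => ?_⟩
    rw [← hin (hm p) (hm ⟨q, hq⟩), ← hin hw (hm ⟨q, hq⟩)]
    exact hp ⟨q, hq⟩
  rw [l2Proj, dif_pos hex]
  exact hex.choose_spec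

theorem integrable_inner_of_memLp {F G : E n → E n} (hF : MemLp F 2 (volume.restrict D))
    (hG : MemLp G 2 (volume.restrict D)) :
    Integrable (fun x => inner ℝ (F x) (G x)) (volume.restrict D) := by
  refine (L2.integrable_inner (𝕜 := ℝ) (hF.toLp F) (hG.toLp G)).congr ?_
  filter_upwards [hF.coeFn_toLp, hG.coeFn_toLp] with x h1 h2
  rw [h1, h2]

theorem integrable_inner_gradient {G : E n → E n} (hG : MemLp G 2 (volume.restrict D))
    {φ : E n → ℝ} (hφ : ContDiff ℝ (⊤ : ℕ∞) φ) (hc : HasCompactSupport φ) :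
    Integrable (fun x => inner ℝ (G x) (gradient φ x)) (volume.restrict D) :=
  integrable_inner_of_memLp hG <| ((continuous_gradient (hφ.of_le (by exact_mod_cast le_top))
    ).memLp_of_hasCompactSupport (hasCompactSupport_gradient hc)).restrict D

/-! ### Weak Laplacians -/

theorem HasWeakLaplacian.add_smul (hD : IsOpen D)
    {u v r s : E n → ℝ} (hu : MemH1 D u)
    (hv : MemH1 D v) (hr : Continuous r) (hs : Continuous s) (hur : HasWeakLaplacian D u r)
    (hvs : HasWeakLaplacian D v s) (c : ℝ) :
    HasWeakLaplacian D (u + c • v) (r + c • s) := by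
  intro φ hφ hc hsup
  have hi : ∀ r : E n → ℝ, Continuous r →
      Integrable (fun x => r x * φ x) (volume.restrict D) := fun r hr =>
    ((hr.mul hφ.continuous).integrable_of_hasCompactSupport hc.mul_left).integrableOn
  have e1 : ∫ x in D, inner ℝ (wgrad D (u + c • v) x) (gradient φ x) =
      ∫ x in D, (inner ℝ (wgrad D u x) (gradient φ x) +
        c * inner ℝ (wgrad D v x) (gradient φ x)) := by
    refine integral_congr_ae ?_
    filter_upwards [(hu.isWeakGrad.add_smul hv.isWeakGrad c).wgrad_ae_eq hD] with x hx
    rw [hx]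
    rw [Pi.add_apply, Pi.smul_apply, inner_add_left, real_inner_smul_left]
  have e2 : ∀ x, (r + c • s) x * φ x = r x * φ x + c * (s x * φ x) := by
    intro x; simp; ring
  simp_rw [e1, e2]
  rw [integral_add (integrable_inner_gradient hu.isWeakGrad.2.1 hφ hc)
      ((integrable_inner_gradient hv.isWeakGrad.2.1 hφ hc).const_mul c),
    integral_add (hi r hr) ((hi s hs).const_mul c), integral_const_mul, integral_const_mul,
    hur φ hφ hc hsup, hvs φ hφ hc hsup]
  ring

/-- The classical Laplacian, a sum of second derivatives each lowering the degree by two, is the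
weak one by coordinatewise integration by parts. -/
theorem exists_hasWeakLaplacian (hD : IsOpen D) (hb : Bornology.IsBounded D) {j : ℤ}
    {p : E n → ℝ} (hp : p ∈ P n j) : ∃ r ∈ P n (j - 2), HasWeakLaplacian D p r := by
  refine ⟨∑ i, fun x => gradient (fun y => gradient p y i) x i,
    Submodule.sum_mem _ fun i _ => ?_, fun φ hφ hc hs => ?_⟩
  · convert gradient_mem_P (gradient_mem_P hp i) i using 1
    congr 1; ring
  · have hφ1 : ContDiff ℝ 1 φ := hφ.of_le (by exact_mod_cast le_top)
    have e1 : ∫ x in D, inner ℝ (wgrad D p x) (gradient φ x) =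
        ∫ x in D, ∑ i, gradient p x i * gradient φ x i := by
      refine integral_congr_ae ?_
      filter_upwards [(isWeakGrad_of_mem_P hb hp).wgrad_ae_eq hD] with x hx
      rw [hx, PiLp.inner_apply]
      simp [mul_comm]
    have hφg : ∀ i, Continuous fun x => gradient φ x i := fun i =>
      (EuclideanSpace.proj i : E n →L[ℝ] ℝ).continuous.comp (continuous_gradient hφ1)
    have hcg : ∀ i, HasCompactSupport fun x => gradient φ x i := fun i =>
      (hasCompactSupport_gradient hc).comp_left (g := fun y : E n => y i) rfl
    rw [e1, integral_finsetSum]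
    · simp_rw [Finset.sum_apply, Finset.sum_mul]
      rw [integral_finsetSum, ← Finset.sum_neg_distrib]
      · refine Finset.sum_congr rfl fun i _ => ?_
        rw [setIntegral_mul_gradient (contDiff_of_mem_P (gradient_mem_P hp i)) hφ1 hc hs i]
        simp_rw [mul_comm]
      · intro i _
        exact (((continuous_of_mem_P (gradient_mem_P (gradient_mem_P hp i) i)).mul
          hφ.continuous).integrable_of_hasCompactSupport hc.mul_left).integrableOn
    · intro i _
      exact (((continuous_of_mem_P (gradient_mem_P hp i)).mul
        (hφg i)).integrable_of_hasCompactSupport (hcg i).mul_left).integrableOn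

end WeakGradient

/-! ### The polynomial trace inequality -/

/-- The map from polynomials to L² of the small ball is injective on a finite-dimensional space,
hence bounded below; and each basis polynomial is bounded on the closed unit ball. -/
theorem exists_sq_le_integral_ball (n : ℕ) (j : ℤ) {γ : ℝ} (hγ : 0 < γ) :
    ∃ C : ℝ, 0 < C ∧ ∀ p ∈ P n j, ∀ y ∈ Metric.closedBall (0 : E n) 1,
      p y ^ 2 ≤ C * ∫ x in Metric.ball (0 : E n) γ, p x ^ 2 := by
  set B := Metric.ball (0 : E n) γ
  have hB : Bornology.IsBounded B := Metric.isBounded_ball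
  have hm : ∀ p : P n j, MemLp (p : E n → ℝ) 2 (volume.restrict B) := fun p =>
    memLp_of_continuous_of_isBounded hB (continuous_of_mem_P p.2)
  let T : P n j →ₗ[ℝ] Lp ℝ 2 (volume.restrict B) :=
    { toFun := fun p => (hm p).toLp _
      map_add' := fun p q => rfl
      map_smul' := fun c p => rfl }
  have hT : Function.Injective T := by
    rw [injective_iff_map_eq_zero]
    intro p hp
    have h0 : (p : E n → ℝ) =ᵐ[volume.restrict B] 0 := (MemLp.toLp_eq_toLp_iff (hm p) MemLp.zero).1
      (hp.trans (MemLp.toLp_zero _).symm)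
    have h1 := Measure.eqOn_open_of_ae_eq h0 Metric.isOpen_ball
      (continuous_of_mem_P p.2).continuousOn continuousOn_const
    exact Subtype.ext (eq_zero_of_eqOn_open p.2 Metric.isOpen_ball (Metric.nonempty_ball.2 hγ) h1)
  -- Coordinates in a basis supply the norm for which the lower bound is stated.
  let b := Module.finBasis ℝ (P n j)
  obtain ⟨K, hK, hanti⟩ := (T ∘ₗ b.equivFun.symm.toLinearMap).injective_iff_antilipschitz.1
    (hT.comp b.equivFun.symm.injective)
  have hbd : ∀ i, ∃ M, ∀ y ∈ Metric.closedBall (0 : E n) 1, ‖(b i : E n → ℝ) y‖ ≤ M := fun i =>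
    (isCompact_closedBall _ _).exists_bound_of_continuousOn
      (continuous_of_mem_P (b i).2).continuousOn
  choose M hM using hbd
  refine ⟨((∑ i, M i) * K) ^ 2 + 1, by positivity, fun p hp y hy => ?_⟩
  set c := b.equivFun ⟨p, hp⟩ with hc
  have hpc : p = ∑ i, c i • (b i : E n → ℝ) := by
    have := congrArg Subtype.val (b.sum_equivFun ⟨p, hp⟩)
    simp only [AddSubmonoidClass.coe_finsetSum, Submodule.coe_smul] at this
    exact this.symm
  have hnorm : ‖c‖ ≤ K * ‖T ⟨p, hp⟩‖ := by
    have := ZeroHomClass.bound_of_antilipschitz _ hanti c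
    simpa [hc] using this
  have hTn : ‖T ⟨p, hp⟩‖ ^ 2 = ∫ x in B, p x ^ 2 := by
    rw [← real_inner_self_eq_norm_sq, L2.inner_def]
    refine integral_congr_ae ?_
    filter_upwards [(hm ⟨p, hp⟩).coeFn_toLp] with x hx
    change inner ℝ ((hm ⟨p, hp⟩).toLp _ x) ((hm ⟨p, hp⟩).toLp _ x) = _
    rw [hx]
    simp [sq]
  have hy1 : |p y| ≤ (∑ i, M i) * ‖c‖ := by
    rw [hpc, Finset.sum_apply, Finset.sum_mul]
    refine (Finset.abs_sum_le_sum_abs _ _).trans (Finset.sum_le_sum fun i _ => ?_)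
    rw [Pi.smul_apply, smul_eq_mul, abs_mul, mul_comm]
    exact mul_le_mul (hM i y hy) (norm_le_pi_norm c i) (abs_nonneg _)
      ((norm_nonneg _).trans (hM i y hy))
  have hMn : 0 ≤ ∑ i, M i := Finset.sum_nonneg fun i _ => (norm_nonneg _).trans (hM i y hy)
  have hy2 : |p y| ≤ (∑ i, M i) * K * ‖T ⟨p, hp⟩‖ := by
    rw [mul_assoc]; exact hy1.trans (mul_le_mul_of_nonneg_left hnorm hMn)
  rw [← sq_abs, ← hTn]
  calc |p y| ^ 2 ≤ ((∑ i, M i) * K * ‖T ⟨p, hp⟩‖) ^ 2 := by gcongr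
    _ ≤ (((∑ i, M i) * K) ^ 2 + 1) * ‖T ⟨p, hp⟩‖ ^ 2 := by
      rw [mul_pow]; gcongr; linarith

/-- Apply the reference estimate to z ↦ p(hz + x); the change of variables produces the factor h⁻ⁿ.
-/
theorem exists_sq_le_integral_scaled_ball (n : ℕ) (j : ℤ) {γ : ℝ} (hγ : 0 < γ) :
    ∃ C : ℝ, 0 < C ∧ ∀ p ∈ P n j, ∀ (x : E n) (h : ℝ), 0 < h → ∀ y ∈ Metric.closedBall x h,
      p y ^ 2 ≤ C * (h ^ n)⁻¹ * ∫ z in Metric.ball x (γ * h), p z ^ 2 := by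
  obtain ⟨C, hC, hbd⟩ := exists_sq_le_integral_ball n j hγ
  refine ⟨C, hC, fun p hp x h hh y hy => ?_⟩
  let A : E n →ᵃ[ℝ] E n := (h • LinearMap.id : E n →ₗ[ℝ] E n).toAffineMap + AffineMap.const ℝ _ x
  have hA : ∀ z, A z = h • z + x := fun z => by simp [A]
  have hq := hbd _ (comp_affine_mem_P hp A) (h⁻¹ • (y - x)) (by
    rw [mem_closedBall_zero_iff, norm_smul, norm_inv, Real.norm_of_nonneg hh.le,
      inv_mul_le_iff₀ hh, mul_one, ← dist_eq_norm]
    exact hy)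
  simp only [hA] at hq
  rw [smul_smul, mul_inv_cancel₀ hh.ne', one_smul, sub_add_cancel] at hq
  refine hq.trans (le_of_eq ?_)
  have h1 := Measure.setIntegral_comp_smul_of_pos (volume : Measure (E n))
    (fun z => p (z + x) ^ 2) (Metric.ball 0 γ) hh
  rw [h1, smul_ball hh.ne', smul_zero, Real.norm_of_nonneg hh.le, finrank_euclideanSpace_fin,
    smul_eq_mul, mul_assoc]
  have h2 := (measurePreserving_add_right (volume : Measure (E n)) x).setIntegral_preimage_emb
    (MeasurableEquiv.addRight x).measurableEmbedding (fun z => p z ^ 2) (Metric.ball x (γ * h))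
  rw [← h2]
  congr 3
  rw [mul_comm]
  congr 1
  ext z
  simp [dist_eq_norm]

theorem volume_real_le_of_diam_le {n : ℕ} {D : Set (E n)} {h : ℝ} (hh : 0 ≤ h)
    (hb : ∀ x ∈ D, ∀ y ∈ D, dist x y ≤ h) :
    volume.real D ≤ h ^ n * volume.real (Metric.ball (0 : E n) 1) := by
  obtain rfl | ⟨x, hx⟩ := D.eq_empty_or_nonempty
  · simp; positivity
  · have h1 : D ⊆ Metric.closedBall x h := fun y hy => hb y hy x hx
    refine (measureReal_mono h1 measure_closedBall_lt_top.ne).trans (le_of_eq ?_)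
    rw [measureReal_def, Measure.addHaar_closedBall _ _ hh, ENNReal.toReal_mul,
      ENNReal.toReal_ofReal (by positivity), finrank_euclideanSpace_fin, measureReal_def]

namespace PolyMesh

variable {n : ℕ} {Ω : Set (E (n + 1))} (T : PolyMesh n Ω)

/-! ### The inverse inequality on shape regular elements -/

theorem hK_pos (K : Fin T.numElem) : 0 < T.hK K := by
  obtain ⟨ho, hc, hb, -⟩ := T.elem_domain K
  obtain ⟨x, hx⟩ := hc.nonempty
  refine Metric.diam_pos ?_ hb
  by_contra hs
  rw [Set.not_nontrivial_iff] at hs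
  have h1 := hs.eq_singleton_of_mem hx
  rw [h1] at ho
  exact not_isOpen_singleton x ho

theorem chart_mem_closure {K : Fin T.numElem} {f : Fin T.numFace} (hf : f ∈ T.facesOf K)
    {x : E n} (hx : x ∈ T.dom f) : T.chart f x ∈ closure (T.elem K) := by
  refine frontier_subset_closure ?_
  rw [T.frontier_elem K]
  exact Set.mem_biUnion hf ⟨x, subset_closure hx, rfl⟩

theorem dist_le_hK {K : Fin T.numElem} {x y : E (n + 1)} (hx : x ∈ closure (T.elem K))
    (hy : y ∈ closure (T.elem K)) : dist x y ≤ T.hK K := by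
  rw [hK, ← Metric.diam_closure]
  exact Metric.dist_le_diam_of_mem (T.elem_domain K).2.2.1.closure hx hy

theorem exists_inverseTrace (n k : ℕ) {γ₀ : ℝ} (hγ₀ : 0 < γ₀) (N₀ : ℕ) :
    ∃ C : ℝ, 0 < C ∧ ∀ (Ω : Set (E (n + 1))) (T : PolyMesh n Ω),
      T.ShapeRegular γ₀ N₀ → T.InverseTrace k C := by
  obtain ⟨C, hC, hbd⟩ := exists_sq_le_integral_scaled_ball (n + 1) k hγ₀
  set V := volume.real (Metric.ball (0 : E n) 1)
  have hV : 0 ≤ V := measureReal_nonneg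
  -- The added one keeps the constant positive even for `N₀ = 0`.
  refine ⟨√(N₀ * C * V + 1), by positivity, fun Ω T hT K p hp => ?_⟩
  obtain ⟨⟨x, ρ, hρ, hstar⟩, hN, -⟩ := hT K
  set h := T.hK K
  have hh : 0 < h := T.hK_pos K
  obtain ⟨ho, hc, hb, -⟩ := T.elem_domain K
  have hρ0 : 0 < ρ := (mul_pos hγ₀ hh).trans_le hρ
  -- Star-shapedness enters only here: every point of the ball is a star centre of the nonempty set
  -- K and hence belongs to it.
  have hball : Metric.ball x (γ₀ * h) ⊆ T.elem K := fun y hy =>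
    (hstar y (Metric.ball_subset_ball hρ hy)).mem hc.nonempty
  have hx : x ∈ T.elem K := hball (Metric.mem_ball_self (mul_pos hγ₀ hh))
  have hint : IntegrableOn (fun z => p z ^ 2) (T.elem K) := by
    have := memLp_of_continuous_of_isBounded hb ((continuous_of_mem_P hp).pow 2) (p := 1)
    exact memLp_one_iff_integrable.1 this
  set I := ∫ z in T.elem K, p z ^ 2
  have hI : 0 ≤ I := integral_nonneg fun z => sq_nonneg _
  have hpt : ∀ y ∈ closure (T.elem K), p y ^ 2 ≤ C * (h ^ (n + 1))⁻¹ * I := by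
    intro y hy
    refine (hbd p hp x h hh y (T.dist_le_hK hy (subset_closure hx))).trans ?_
    gcongr
    exact setIntegral_mono_set hint (ae_of_all _ fun z => sq_nonneg _)
      (LE.le.eventuallyLE hball)
  have hface : ∀ f ∈ T.facesOf K, T.faceInt f (fun z => p z ^ 2) ≤ C * V * h⁻¹ * I := by
    intro f hf
    have hm : MeasurableSet (T.dom f) := (T.dom_domain f).1.measurableSet
    have hfin : volume (T.dom f) < ⊤ := (T.dom_domain f).2.2.1.measure_lt_top
    have h1 : T.faceInt f (fun z => p z ^ 2) ≤
        ∫ z in T.dom f, C * (h ^ (n + 1))⁻¹ * I := by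
      refine setIntegral_mono_on ?_ (integrableOn_const hfin.ne) hm
        fun z hz => hpt _ (T.chart_mem_closure hf hz)
      exact memLp_one_iff_integrable.1 (memLp_of_continuous_of_isBounded (T.dom_domain f).2.2.1
        (((continuous_of_mem_P hp).comp (T.chart f).continuous).pow 2))
    have h2 : volume.real (T.dom f) ≤ h ^ n * V :=
      volume_real_le_of_diam_le hh.le fun y hy z hz => by
        rw [← (T.chart f).dist_map]
        exact T.dist_le_hK (T.chart_mem_closure hf hy) (T.chart_mem_closure hf hz)
    refine h1.trans ?_
    rw [setIntegral_const, smul_eq_mul]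
    calc volume.real (T.dom f) * (C * (h ^ (n + 1))⁻¹ * I)
        ≤ h ^ n * V * (C * (h ^ (n + 1))⁻¹ * I) := by gcongr
      _ = C * V * h⁻¹ * I := by field_simp; ring
  have htot : T.bdryInt K (fun z => p z ^ 2) ≤ (N₀ * C * V + 1) * h⁻¹ * I := by
    refine (Finset.sum_le_card_nsmul _ _ _ hface).trans ?_
    rw [nsmul_eq_mul]
    calc ((T.facesOf K).card : ℝ) * (C * V * h⁻¹ * I) ≤ N₀ * (C * V * h⁻¹ * I) := by gcongr
      _ ≤ (N₀ * C * V + 1) * h⁻¹ * I := by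
        have : 0 ≤ h⁻¹ * I := by positivity
        nlinarith
  have hpow : h ^ (-(1 / 2) : ℝ) = √(h⁻¹) := by
    rw [Real.sqrt_eq_rpow, Real.inv_rpow hh.le, Real.rpow_neg hh.le]
  rw [hpow, ← Real.sqrt_mul (by positivity), ← Real.sqrt_mul (by positivity)]
  exact Real.sqrt_le_sqrt htot

end PolyMesh

/-! ### The local virtual element space -/

theorem tendsto_eLpNorm_add_smul {α F : Type*} [MeasurableSpace α] {μ : Measure α}
    [NormedAddCommGroup F] [NormedSpace ℝ F] {f g : ℕ → α → F}
    (hfm : ∀ j, AEStronglyMeasurable (f j) μ) (hgm : ∀ j, AEStronglyMeasurable (g j) μ)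
    (hf : Tendsto (fun j => eLpNorm (f j) 2 μ) atTop (𝓝 0))
    (hg : Tendsto (fun j => eLpNorm (g j) 2 μ) atTop (𝓝 0)) (c : ℝ) :
    Tendsto (fun j => eLpNorm (f j + c • g j) 2 μ) atTop (𝓝 0) := by
  have h := hf.add (ENNReal.Tendsto.const_mul (a := ‖c‖ₑ) hg (Or.inr (by simp)))
  rw [mul_zero, add_zero] at h
  refine tendsto_of_tendsto_of_tendsto_of_le_of_le tendsto_const_nhds h (fun _ => zero_le)
    fun j => ?_
  refine (eLpNorm_add_le (hfm j) ((hgm j).const_smul c) one_le_two).trans ?_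
  rw [eLpNorm_const_smul]

theorem IsGradProj.add_smul {n : ℕ} {D : Set (E n)} (hD : IsOpen D) (hb : Bornology.IsBounded D)
    {k : ℕ} {u v p q : E n → ℝ} (hu : MemH1 D u) (hv : MemH1 D v) (hp : IsGradProj D k u p)
    (hq : IsGradProj D k v q) (c : ℝ) : IsGradProj D k (u + c • v) (p + c • q) := by
  rw [isGradProj_iff hD hb] at *
  refine ⟨Submodule.add_mem _ hp.1 (Submodule.smul_mem _ _ hq.1), fun w hw => ?_⟩
  rw [gradLp_add_smul hD hu hv, gradLp_add_smul hD (memH1_of_mem_P hb hp.1)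
    (memH1_of_mem_P hb hq.1), inner_add_left, inner_add_left, inner_smul_left, inner_smul_left,
    hp.2 w hw, hq.2 w hw]

theorem isGradProj_self {n : ℕ} {D : Set (E n)} (hD : IsOpen D) (hb : Bornology.IsBounded D)
    {k : ℕ} {p : E n → ℝ} (hp : p ∈ P n k) : IsGradProj D k p p :=
  (isGradProj_iff hD hb).2 ⟨hp, fun _ _ => rfl⟩

/-- Cauchy–Schwarz for a bilinear form that is nonnegative on a set closed under linear
combinations. -/
theorem abs_apply_le_sqrt_mul_sqrt {V : Type*} [AddCommGroup V] [Module ℝ V]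
    (B : LinearMap.BilinForm ℝ V) {N : Set V} (hN : ∀ x ∈ N, ∀ y ∈ N, ∀ c : ℝ, x + c • y ∈ N)
    (hB : ∀ x ∈ N, 0 ≤ B x x) {x y : V} (hx : x ∈ N) (hy : y ∈ N) (hxy : B x y = B y x) :
    |B x y| ≤ √(B x x) * √(B y y) := by
  have h : ∀ t : ℝ, 0 ≤ B y y * (t * t) + 2 * B x y * t + B x x := by
    intro t
    have := hB _ (hN x hx y hy t)
    simp only [map_add, map_smul, LinearMap.add_apply, LinearMap.smul_apply, smul_eq_mul,
      ← hxy] at this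
    linarith
  have hd := discrim_le_zero h
  rw [discrim] at hd
  rw [← Real.sqrt_mul (hB x hx), ← Real.sqrt_sq_eq_abs]
  exact Real.sqrt_le_sqrt (by nlinarith)

namespace PolyMesh

variable {n : ℕ} {Ω : Set (E (n + 1))} {T : PolyMesh n Ω} {k : ℕ}
  {M' M : Fin T.numFace → Set (E n → ℝ)}

/-- Edges lie in the frontier of the face, so continuity on the closed face makes the edge integrals
additive. -/
theorem edgeInt_add_smul (hn : n = 2) {f : Fin T.numFace} {v w : E n → ℝ}
    (hv : ContinuousOn v (closure (T.dom f))) (hw : ContinuousOn w (closure (T.dom f))) (c : ℝ) :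
    T.edgeInt f (v + c • w) = T.edgeInt f v + c * T.edgeInt f w := by
  have hi : ∀ u : E n → ℝ, ContinuousOn u (closure (T.dom f)) → ∀ e ∈ T.edges f,
      IntervalIntegrable (fun t => u (AffineMap.lineMap e.1 e.2 t)) volume (0 : ℝ) 1 := by
    intro u hu e he
    refine ContinuousOn.intervalIntegrable ?_
    rw [Set.uIcc_of_le zero_le_one]
    refine hu.comp (AffineMap.lineMap_continuous).continuousOn fun t ht => ?_
    refine frontier_subset_closure ?_
    rw [T.edges_cover hn f]
    refine Set.mem_biUnion he ?_
    rw [segment_eq_image_lineMap]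
    exact ⟨t, ht, rfl⟩
  simp only [edgeInt, Finset.mul_sum]
  rw [← Finset.sum_add_distrib]
  refine Finset.sum_congr rfl fun e he => ?_
  simp only [Pi.add_apply, Pi.smul_apply, smul_eq_mul]
  rw [intervalIntegral.integral_add (hi v hv e he) ((hi w hw e he).const_mul c),
    intervalIntegral.integral_const_mul]
  ring

/-- All constraints are linear, including the enhancement condition, because face projections of `v`
and `w` combine to one of `v + c • w`. This is what lets differences u - Π^∇ u stay in the local
space. -/
theorem faceSpace_add_smul (hM : T.IsFaceBases k M' M) {f : Fin T.numFace} {v w : E n → ℝ}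
    (hv : v ∈ T.faceSpace k M' M f) (hw : w ∈ T.faceSpace k M' M f) (c : ℝ) :
    v + c • w ∈ T.faceSpace k M' M f := by
  obtain ⟨ho, -, hb, -⟩ := T.dom_domain f
  refine ⟨fun hn => ?_, fun hn => ?_⟩
  · obtain ⟨p, hp, hvp⟩ := hv.1 hn
    obtain ⟨q, hq, hwq⟩ := hw.1 hn
    exact ⟨p + c • q, Submodule.add_mem _ hp (Submodule.smul_mem _ _ hq), fun x hx => by
      simp [hvp hx, hwq hx]⟩
  · obtain ⟨vc, vH, ve, ⟨r, hr, vr⟩, p, ⟨hp, hpe⟩, vq⟩ := hv.2 hn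
    obtain ⟨wc, wH, we, ⟨s, hs, ws⟩, q, ⟨hq, hqe⟩, wq⟩ := hw.2 hn
    refine ⟨vc.add (wc.const_smul c), vH.add_smul wH c, fun e he => ?_,
      ⟨r + c • s, Submodule.add_mem _ hr (Submodule.smul_mem _ _ hs), vr.add_smul ho vH wH
        (continuous_of_mem_P hr) (continuous_of_mem_P hs) ws c⟩,
      p + c • q, ⟨hp.add_smul ho hb vH wH hq c, ?_⟩, fun m hm => ?_⟩
    · obtain ⟨p, hp, hvp⟩ := ve e he
      obtain ⟨q, hq, hwq⟩ := we e he
      exact ⟨p + c • q, Submodule.add_mem _ hp (Submodule.smul_mem _ _ hq), fun x hx => by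
        simp [hvp hx, hwq hx]⟩
    · rw [edgeInt_add_smul hn vc wc, edgeInt_add_smul hn (continuous_of_mem_P hp.1).continuousOn
        (continuous_of_mem_P hq.1).continuousOn, hpe, hqe]
    · have hmP : m ∈ P n k := by
        rw [← (hM f).2.2.1]; exact Submodule.subset_span hm.1
      have hmL : MemLp m 2 (volume.restrict (T.dom f)) :=
        memLp_of_continuous_of_isBounded hb (continuous_of_mem_P hmP)
      have hlin : ∀ a b : E n → ℝ, MemLp a 2 (volume.restrict (T.dom f)) →
          MemLp b 2 (volume.restrict (T.dom f)) →
          ∫ x in T.dom f, m x * (a + c • b) x =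
            (∫ x in T.dom f, m x * a x) + c * ∫ x in T.dom f, m x * b x := by
        intro a b ha hb
        have hma : Integrable (fun x => m x * a x) (volume.restrict (T.dom f)) :=
          hmL.integrable_mul ha
        have hmb : Integrable (fun x => m x * b x) (volume.restrict (T.dom f)) :=
          hmL.integrable_mul hb
        rw [← integral_const_mul, ← integral_add hma (hmb.const_mul c)]
        refine integral_congr_ae (ae_of_all _ fun x => ?_)
        simp only [Pi.add_apply, Pi.smul_apply, smul_eq_mul]
        ring
      rw [hlin _ _ vH.isWeakGrad.1 wH.isWeakGrad.1, hlin _ _ (memH1_of_mem_P hb hp.1).isWeakGrad.1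
        (memH1_of_mem_P hb hq.1).isWeakGrad.1, vq m hm, wq m hm]

/-- A polynomial is its own projection, so the enhancement condition is trivial. -/
theorem mem_faceSpace_of_mem_P {p : E n → ℝ} (hp : p ∈ P n k) (f : Fin T.numFace) :
    p ∈ T.faceSpace k M' M f := by
  obtain ⟨ho, -, hb, -⟩ := T.dom_domain f
  refine ⟨fun _ => ⟨p, hp, fun x _ => rfl⟩, fun _ => ⟨(continuous_of_mem_P hp).continuousOn,
    memH1_of_mem_P hb hp, fun e _ => ⟨p, hp, fun x _ => rfl⟩, ?_,
    p, ⟨isGradProj_self ho hb hp, rfl⟩, fun q _ => rfl⟩⟩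
  obtain ⟨r, hr, h⟩ := exists_hasWeakLaplacian ho hb hp
  exact ⟨r, P_mono n (by omega) hr, h⟩

/-- Combine the approximating sequences. Later arguments only need some trace to exist, or refer to
one fixed choice, so uniqueness of traces never enters. -/
theorem HasTrace.add_smul {K : Fin T.numElem} {u v g h : E (n + 1) → ℝ} (hu : T.HasTrace K u g)
    (hv : T.HasTrace K v h) (c : ℝ) : T.HasTrace K (u + c • v) (g + c • h) := by
  obtain ⟨ho, -, hb, -⟩ := T.elem_domain K
  obtain ⟨uH, gm, φ, hφ, hφu, hφg, hφf⟩ := hu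
  obtain ⟨vH, hm, ψ, hψ, hψv, hψg, hψf⟩ := hv
  have h1 : ∀ {φ : E (n + 1) → ℝ}, ContDiff ℝ (⊤ : ℕ∞) φ → ContDiff ℝ 1 φ := fun hφ =>
    hφ.of_le (by exact_mod_cast le_top)
  have hgm : ∀ {φ : E (n + 1) → ℝ} (u : E (n + 1) → ℝ), ContDiff ℝ (⊤ : ℕ∞) φ →
      AEStronglyMeasurable (fun x => gradient φ x - wgrad (T.elem K) u x)
        (volume.restrict (T.elem K)) := fun u hφ =>
    (continuous_gradient (h1 hφ)).aestronglyMeasurable.sub (memLp_wgrad _ u).1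
  have hum : ∀ {φ u : E (n + 1) → ℝ}, ContDiff ℝ (⊤ : ℕ∞) φ → MemH1 (T.elem K) u →
      AEStronglyMeasurable (fun x => φ x - u x) (volume.restrict (T.elem K)) := fun hφ hu =>
    hφ.continuous.aestronglyMeasurable.sub hu.isWeakGrad.1.1
  refine ⟨uH.add_smul vH c, fun f hf => (gm f hf).add ((hm f hf).const_smul c),
    fun j => φ j + c • ψ j, fun j => (hφ j).add (contDiff_const.smul (hψ j)), ?_, ?_,
    fun f hf => ?_⟩
  · refine (tendsto_eLpNorm_add_smul (fun j => hum (hφ j) uH) (fun j => hum (hψ j) vH)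
      hφu hψv c).congr fun j => ?_
    congr 1
    ext x
    simp only [Pi.add_apply, Pi.smul_apply, smul_eq_mul]
    ring
  · refine (tendsto_eLpNorm_add_smul (fun j => hgm u (hφ j)) (fun j => hgm v (hψ j))
      hφg hψg c).congr fun j => ?_
    refine eLpNorm_congr_ae ?_
    filter_upwards [(uH.isWeakGrad.add_smul vH.isWeakGrad c).wgrad_ae_eq ho] with x hx
    rw [hx, gradient_add_smul ((h1 (hφ j)).differentiable one_ne_zero x)
      ((h1 (hψ j)).differentiable one_ne_zero x)]
    simp only [Pi.add_apply, Pi.smul_apply]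
    module
  · have hfm : ∀ {φ g : E (n + 1) → ℝ}, ContDiff ℝ (⊤ : ℕ∞) φ →
        MemLp (fun x => g (T.chart f x)) 2 (volume.restrict (T.dom f)) →
        AEStronglyMeasurable (fun x => φ (T.chart f x) - g (T.chart f x))
          (volume.restrict (T.dom f)) := fun hφ hg =>
      (hφ.continuous.comp (T.chart f).continuous).aestronglyMeasurable.sub hg.1
    refine (tendsto_eLpNorm_add_smul (fun j => hfm (hφ j) (gm f hf))
      (fun j => hfm (hψ j) (hm f hf)) (hφf f hf) (hψf f hf) c).congr fun j => ?_
    congr 1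
    ext x
    simp only [Pi.add_apply, Pi.smul_apply, smul_eq_mul]
    ring

theorem hasTrace_of_mem_P {j : ℤ} {p : E (n + 1) → ℝ} (hp : p ∈ P (n + 1) j)
    (K : Fin T.numElem) : T.HasTrace K p p := by
  obtain ⟨ho, -, hb, -⟩ := T.elem_domain K
  refine ⟨memH1_of_mem_P hb hp, fun f _ => memLp_of_continuous_of_isBounded (T.dom_domain f).2.2.1
    ((continuous_of_mem_P hp).comp (T.chart f).continuous), fun _ => p,
    fun _ => contDiff_of_mem_P hp, by simp, ?_, by simp⟩
  have : eLpNorm (fun x => gradient p x - wgrad (T.elem K) p x) 2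
      (volume.restrict (T.elem K)) = 0 := by
    rw [← eLpNorm_zero (α := E (n + 1)) (ε := E (n + 1)) (p := 2) (μ := volume.restrict (T.elem K))]
    refine eLpNorm_congr_ae ?_
    filter_upwards [(isWeakGrad_of_mem_P hb hp).wgrad_ae_eq ho] with x hx
    simp [hx]
  simp [this]

theorem elemSpace_add_smul (hM : T.IsFaceBases k M' M) {K : Fin T.numElem}
    {u v : E (n + 1) → ℝ} (hu : u ∈ T.elemSpace k M' M K) (hv : v ∈ T.elemSpace k M' M K)
    (c : ℝ) : u + c • v ∈ T.elemSpace k M' M K := by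
  obtain ⟨uH, ⟨g, ⟨gc, gf⟩, hg⟩, r, hr, ur⟩ := hu
  obtain ⟨vH, ⟨h, ⟨hc, hf⟩, hh⟩, s, hs, vs⟩ := hv
  exact ⟨uH.add_smul vH c, ⟨g + c • h, ⟨gc.add (hc.const_smul c), fun f hfK =>
    faceSpace_add_smul hM (gf f hfK) (hf f hfK) c⟩, hg.add_smul hh c⟩,
    r + c • s, Submodule.add_mem _ hr (Submodule.smul_mem _ _ hs),
    ur.add_smul (T.elem_domain K).1 uH vH (continuous_of_mem_P hr) (continuous_of_mem_P hs) vs c⟩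

theorem mem_elemSpace_of_mem_P {p : E (n + 1) → ℝ} (hp : p ∈ P (n + 1) k) (K : Fin T.numElem) :
    p ∈ T.elemSpace k M' M K := by
  obtain ⟨ho, -, hb, -⟩ := T.elem_domain K
  exact ⟨memH1_of_mem_P hb hp, ⟨p, ⟨(continuous_of_mem_P hp).continuousOn, fun f _ =>
    mem_faceSpace_of_mem_P (comp_affine_mem_P hp (T.chart f).toAffineMap) f⟩,
    hasTrace_of_mem_P hp K⟩, exists_hasWeakLaplacian ho hb hp⟩

theorem bdryInt_add_smul {K : Fin T.numElem} {g h : E (n + 1) → ℝ}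
    (hg : ∀ f ∈ T.facesOf K, MemLp (fun x => g (T.chart f x)) 2 (volume.restrict (T.dom f)))
    (hh : ∀ f ∈ T.facesOf K, MemLp (fun x => h (T.chart f x)) 2 (volume.restrict (T.dom f)))
    (c : ℝ) : T.bdryInt K (g + c • h) = T.bdryInt K g + c * T.bdryInt K h := by
  simp only [bdryInt, Finset.mul_sum, faceInt]
  rw [← Finset.sum_add_distrib]
  refine Finset.sum_congr rfl fun f hf => ?_
  have hb := (T.dom_domain f).2.2.1
  rw [← integral_const_mul, ← integral_add (integrableOn_of_memLp_two hb (hg f hf))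
    ((integrableOn_of_memLp_two hb (hh f hf)).const_mul c)]
  rfl

/-- K has at least one face: otherwise its frontier is empty and K, being nonempty and clopen, is
the whole unbounded space. -/
theorem bdryInt_one_pos (K : Fin T.numElem) : 0 < T.bdryInt K fun _ => 1 := by
  obtain ⟨ho, hc, hb, -⟩ := T.elem_domain K
  have hpos : ∀ f, 0 < T.faceInt f fun _ => 1 := by
    intro f
    obtain ⟨hfo, hfc, hfb, -⟩ := T.dom_domain f
    simp only [faceInt, setIntegral_const, smul_eq_mul, mul_one]
    exact ENNReal.toReal_pos (hfo.measure_pos volume hfc.nonempty).ne' hfb.measure_lt_top.ne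
  refine Finset.sum_pos (fun f _ => hpos f) ?_
  by_contra hne
  rw [Finset.not_nonempty_iff_eq_empty] at hne
  have hfr := T.frontier_elem K
  rw [hne] at hfr
  simp only [Finset.notMem_empty, Set.iUnion_of_empty, Set.iUnion_empty] at hfr
  have huniv := (isClopen_iff_frontier_eq_empty.2 hfr).eq_univ hc.nonempty
  rw [huniv] at hb
  exact NormedSpace.unbounded_univ ℝ (E (n + 1)) hb

/-! ### The projection Π^∇ on an element and its kernel -/

/-- A gradient projection may be shifted by a constant; the positive measure of ∂K allows the shift
to match the boundary mean. -/
theorem isPiNabla_piNabla {K : Fin T.numElem} {u : E (n + 1) → ℝ}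
    (hu : ∃ g, T.HasTrace K u g) : T.IsPiNabla k K u (T.piNabla k K u) := by
  have hex : ∃ p, T.IsPiNabla k K u p := by
    obtain ⟨ho, -, hb, -⟩ := T.elem_domain K
    obtain ⟨g, hg⟩ := hu
    obtain ⟨p, hp⟩ := exists_isGradProj ho hb k u
    set c := (T.bdryInt K g - T.bdryInt K p) / T.bdryInt K fun _ => 1
    have h1 : (fun _ => 1 : E (n + 1) → ℝ) ∈ P (n + 1) k := const_mem_P _ (by omega) 1
    refine ⟨p + c • fun _ => 1, ⟨Submodule.add_mem _ hp.1 (Submodule.smul_mem _ _ h1),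
      fun w hw => ?_⟩, g, hg, ?_⟩
    · rw [← hp.2 w hw]
      refine integral_congr_ae (ae_of_all _ fun x => ?_)
      simp only
      rw [gradient_add_smul (differentiable_of_mem_P hp.1 x) (differentiable_of_mem_P h1 x),
        gradient_fun_const, smul_zero, add_zero]
    · rw [bdryInt_add_smul (hasTrace_of_mem_P hp.1 K).2.1 (hasTrace_of_mem_P h1 K).2.1]
      rw [div_mul_cancel₀ _ (bdryInt_one_pos K).ne']
      ring
  rw [piNabla, dif_pos hex]
  exact hex.choose_spec

/-- The part of the local space on which the stabilization is required to be coercive. -/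
def kerPi (T : PolyMesh n Ω) (k : ℕ) (M' M : Fin T.numFace → Set (E n → ℝ))
    (K : Fin T.numElem) : Set (E (n + 1) → ℝ) :=
  {φ | φ ∈ T.elemSpace k M' M K ∧ T.IsPiNabla k K φ 0}

theorem IsPiNabla.add_smul {K : Fin T.numElem} {u v p q : E (n + 1) → ℝ}
    (hp : T.IsPiNabla k K u p) (hq : T.IsPiNabla k K v q) (c : ℝ) :
    T.IsPiNabla k K (u + c • v) (p + c • q) := by
  obtain ⟨ho, -, hb, -⟩ := T.elem_domain K
  obtain ⟨hp, g, hg, hpg⟩ := hp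
  obtain ⟨hq, h, hh, hqh⟩ := hq
  refine ⟨hp.add_smul ho hb hg.1 hh.1 hq c, g + c • h, hg.add_smul hh c, ?_⟩
  rw [bdryInt_add_smul hg.2.1 hh.2.1, bdryInt_add_smul (hasTrace_of_mem_P hp.1 K).2.1
    (hasTrace_of_mem_P hq.1 K).2.1, hpg, hqh]

theorem kerPi_add_smul (hM : T.IsFaceBases k M' M) {K : Fin T.numElem} :
    ∀ u ∈ T.kerPi k M' M K, ∀ v ∈ T.kerPi k M' M K, ∀ c : ℝ, u + c • v ∈ T.kerPi k M' M K :=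
  fun _ hu _ hv c => ⟨elemSpace_add_smul hM hu.1 hv.1 c, by simpa using hu.2.add_smul hv.2 c⟩

theorem isPiNabla_of_mem_elemSpace {K : Fin T.numElem} {u : E (n + 1) → ℝ}
    (hu : u ∈ T.elemSpace k M' M K) : T.IsPiNabla k K u (T.piNabla k K u) :=
  isPiNabla_piNabla (hu.2.1.imp fun _ h => h.2)

theorem piNabla_mem_P {K : Fin T.numElem} {u : E (n + 1) → ℝ}
    (hu : u ∈ T.elemSpace k M' M K) : T.piNabla k K u ∈ P (n + 1) k :=
  (isPiNabla_of_mem_elemSpace hu).1.1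

/-- Polynomials lie in the local space and are fixed by Π^∇, so linearity gives projection zero for
the difference. -/
theorem sub_piNabla_mem_kerPi (hM : T.IsFaceBases k M' M) {K : Fin T.numElem}
    {u : E (n + 1) → ℝ} (hu : u ∈ T.elemSpace k M' M K) :
    u - T.piNabla k K u ∈ T.kerPi k M' M K := by
  obtain ⟨ho, -, hb, -⟩ := T.elem_domain K
  have hp := piNabla_mem_P hu
  have he : u - T.piNabla k K u = u + (-1 : ℝ) • T.piNabla k K u := by
    rw [neg_one_smul, sub_eq_add_neg]
  rw [he]
  refine ⟨elemSpace_add_smul hM hu (mem_elemSpace_of_mem_P hp K) _, ?_⟩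
  have h2 : T.IsPiNabla k K (T.piNabla k K u) (T.piNabla k K u) :=
    ⟨isGradProj_self ho hb hp, _, hasTrace_of_mem_P hp K, rfl⟩
  simpa using (isPiNabla_of_mem_elemSpace hu).add_smul h2 (-1)

/-- Orthogonal decomposition of the local energy. -/
theorem dirichlet_eq_add {K : Fin T.numElem} {u : E (n + 1) → ℝ}
    (hu : u ∈ T.elemSpace k M' M K) :
    dirichlet (T.elem K) u u = dirichlet (T.elem K) (T.piNabla k K u) (T.piNabla k K u) +
      dirichlet (T.elem K) (u - T.piNabla k K u) (u - T.piNabla k K u) := by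
  obtain ⟨ho, -, hb, -⟩ := T.elem_domain K
  obtain ⟨hp, -⟩ := isPiNabla_of_mem_elemSpace hu
  rw [isGradProj_iff ho hb] at hp
  -- Testing with Π^∇ u itself gives (∇Π^∇u, ∇Π^∇u) = (∇u, ∇Π^∇u), hence Pythagoras.
  have h := hp.2 _ hp.1
  have he : u - T.piNabla k K u = u + (-1 : ℝ) • T.piNabla k K u := by
    rw [neg_one_smul, sub_eq_add_neg]
  simp only [dirichlet_eq_inner]
  rw [he, gradLp_add_smul ho hu.1 (memH1_of_mem_P hb hp.1)]
  simp only [inner_add_left, inner_add_right, inner_smul_left, inner_smul_right]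
  rw [real_inner_comm] at h
  simp only [RCLike.conj_to_real]
  have h' := real_inner_comm (gradLp (T.elem K) u) (gradLp (T.elem K) (T.piNabla k K u))
  linarith

theorem dirichlet_self_nonneg {n : ℕ} (D : Set (E n)) (u : E n → ℝ) : 0 ≤ dirichlet D u u := by
  rw [dirichlet_eq_inner]; exact real_inner_self_nonneg

theorem abs_dirichlet_le {n : ℕ} (D : Set (E n)) (u v : E n → ℝ) :
    |dirichlet D u v| ≤ √(dirichlet D u u) * √(dirichlet D v v) := by
  simp only [dirichlet_eq_inner, real_inner_self_eq_norm_sq, Real.sqrt_sq (norm_nonneg _)]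
  exact abs_real_inner_le_norm _ _

/-! ### Bounds for the elemental form -/

variable {cLow cUp : ℝ} {S : Fin T.numElem → LinearMap.BilinForm ℝ (E (n + 1) → ℝ)}

/-- The stabilization is known to be nonnegative only on the kernel of Π^∇, so its Cauchy–Schwarz
inequality is used there. By Pythagoras each part has at most the full energy. -/
theorem abs_ahK_le (hM : T.IsFaceBases k M' M) (hS : T.IsStabilization k M' M cLow cUp S)
    (hc : 0 < cLow) (hC : 0 < cUp) {K : Fin T.numElem} {u v : E (n + 1) → ℝ}
    (hu : u ∈ T.elemSpace k M' M K) (hv : v ∈ T.elemSpace k M' M K) :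
    |T.ahK k S K u v| ≤
      (1 + cUp) * (√(dirichlet (T.elem K) u u) * √(dirichlet (T.elem K) v v)) := by
  have hku := sub_piNabla_mem_kerPi hM hu
  have hkv := sub_piNabla_mem_kerPi hM hv
  have hnn : ∀ φ ∈ T.kerPi k M' M K, 0 ≤ S K φ φ := fun φ hφ =>
    (mul_nonneg hc.le (dirichlet_self_nonneg _ _)).trans ((hS K).2 φ hφ.1 hφ.2).1
  have h1 := abs_apply_le_sqrt_mul_sqrt (S K) (kerPi_add_smul hM) hnn hku hkv
    ((hS K).1 _ hku.1 _ hkv.1)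
  have h2 : ∀ w, w ∈ T.elemSpace k M' M K → √(S K (w - T.piNabla k K w) (w - T.piNabla k K w)) ≤
      √cUp * √(dirichlet (T.elem K) w w) := by
    intro w hw
    rw [← Real.sqrt_mul hC.le]
    have hkw := sub_piNabla_mem_kerPi hM hw
    refine Real.sqrt_le_sqrt (((hS K).2 _ hkw.1 hkw.2).2.trans ?_)
    rw [dirichlet_eq_add hw]
    have := dirichlet_self_nonneg (T.elem K) (T.piNabla k K w)
    nlinarith
  have h3 : ∀ w, w ∈ T.elemSpace k M' M K →
      √(dirichlet (T.elem K) (T.piNabla k K w) (T.piNabla k K w)) ≤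
        √(dirichlet (T.elem K) w w) := by
    intro w hw
    refine Real.sqrt_le_sqrt ?_
    rw [dirichlet_eq_add hw]
    linarith [dirichlet_self_nonneg (T.elem K) (w - T.piNabla k K w)]
  calc |T.ahK k S K u v|
      ≤ |dirichlet (T.elem K) (T.piNabla k K u) (T.piNabla k K v)| +
        |S K (u - T.piNabla k K u) (v - T.piNabla k K v)| := abs_add_le _ _
    _ ≤ √(dirichlet (T.elem K) u u) * √(dirichlet (T.elem K) v v) +
        (√cUp * √(dirichlet (T.elem K) u u)) * (√cUp * √(dirichlet (T.elem K) v v)) := by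
      refine add_le_add ((abs_dirichlet_le _ _ _).trans ?_) (h1.trans ?_)
      · exact mul_le_mul (h3 u hu) (h3 v hv) (Real.sqrt_nonneg _) (Real.sqrt_nonneg _)
      · exact mul_le_mul (h2 u hu) (h2 v hv) (Real.sqrt_nonneg _) (by positivity)
    _ = (1 + √cUp * √cUp) * (√(dirichlet (T.elem K) u u) * √(dirichlet (T.elem K) v v)) := by ring
    _ = _ := by rw [Real.mul_self_sqrt hC.le]

/-- The polynomial energy keeps coefficient one; only the remainder is weighted by `cLow`. This
keeps `cLow` out of the threshold on α. -/
theorem le_ahK_self (hM : T.IsFaceBases k M' M) (hS : T.IsStabilization k M' M cLow cUp S)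
    {K : Fin T.numElem} {u : E (n + 1) → ℝ} (hu : u ∈ T.elemSpace k M' M K) :
    dirichlet (T.elem K) (T.piNabla k K u) (T.piNabla k K u) +
      cLow * dirichlet (T.elem K) (u - T.piNabla k K u) (u - T.piNabla k K u) ≤
        T.ahK k S K u u := by
  have hku := sub_piNabla_mem_kerPi hM hu
  exact add_le_add le_rfl ((hS K).2 _ hku.1 hku.2).1

end PolyMesh

namespace PolyMesh

/-! ### The mesh dependent boundary form -/

variable {n : ℕ} {Ω : Set (E (n + 1))} {T : PolyMesh n Ω} {k k' : ℕ}
  {M' M : Fin T.numFace → Set (E n → ℝ)}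

/-- The form `∑ h̃_f ∫_f w z` over the boundary faces, for families of functions in the charts. -/
def bdryForm (T : PolyMesh n Ω) (w z : Fin T.numElem → Fin T.numFace → E n → ℝ) : ℝ :=
  ∑ K, ∑ f ∈ T.bdryFacesOf K, T.hK K * ∫ x in T.dom f, w K f x * z K f x

/-- Square integrability on every boundary face. -/
def BdryL2 (T : PolyMesh n Ω) (w : Fin T.numElem → Fin T.numFace → E n → ℝ) : Prop :=
  ∀ K, ∀ f ∈ T.bdryFacesOf K, MemLp (w K f) 2 (volume.restrict (T.dom f))

theorem BdryL2.add_smul {w z : Fin T.numElem → Fin T.numFace → E n → ℝ} (hw : T.BdryL2 w)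
    (hz : T.BdryL2 z) (c : ℝ) : T.BdryL2 (w + c • z) := fun K f hf =>
  (hw K f hf).add ((hz K f hf).const_smul c)

theorem bdryForm_comm (w z : Fin T.numElem → Fin T.numFace → E n → ℝ) :
    T.bdryForm w z = T.bdryForm z w := by
  simp only [bdryForm, mul_comm (w _ _ _)]

theorem bdryForm_self_nonneg (w : Fin T.numElem → Fin T.numFace → E n → ℝ) :
    0 ≤ T.bdryForm w w :=
  Finset.sum_nonneg fun K _ => Finset.sum_nonneg fun _ _ =>
    mul_nonneg (T.hK_pos K).le (integral_nonneg fun _ => mul_self_nonneg _)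

theorem bdryForm_add_smul_left {w z y : Fin T.numElem → Fin T.numFace → E n → ℝ}
    (hw : T.BdryL2 w) (hz : T.BdryL2 z) (hy : T.BdryL2 y) (c : ℝ) :
    T.bdryForm (w + c • z) y = T.bdryForm w y + c * T.bdryForm z y := by
  simp only [bdryForm, Finset.mul_sum]
  rw [← Finset.sum_add_distrib]
  refine Finset.sum_congr rfl fun K _ => ?_
  rw [← Finset.sum_add_distrib]
  refine Finset.sum_congr rfl fun f hf => ?_
  have h1 : Integrable (fun x => w K f x * y K f x) (volume.restrict (T.dom f)) :=
    (hw K f hf).integrable_mul (hy K f hf)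
  have h2 : Integrable (fun x => z K f x * y K f x) (volume.restrict (T.dom f)) :=
    (hz K f hf).integrable_mul (hy K f hf)
  rw [mul_left_comm c, ← mul_add, ← integral_const_mul c, ← integral_add h1 (h2.const_mul c)]
  congr 1
  refine integral_congr_ae (ae_of_all _ fun x => ?_)
  simp only [Pi.add_apply, Pi.smul_apply, smul_eq_mul]
  ring

theorem bdryForm_add_smul_right {w z y : Fin T.numElem → Fin T.numFace → E n → ℝ}
    (hw : T.BdryL2 w) (hz : T.BdryL2 z) (hy : T.BdryL2 y) (c : ℝ) :
    T.bdryForm y (w + c • z) = T.bdryForm y w + c * T.bdryForm y z := by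
  rw [bdryForm_comm, bdryForm_add_smul_left hw hz hy, bdryForm_comm w, bdryForm_comm z]

theorem bdryForm_congr_right {w z z' : Fin T.numElem → Fin T.numFace → E n → ℝ}
    (h : ∀ K, ∀ f ∈ T.bdryFacesOf K, Set.EqOn (z K f) (z' K f) (T.dom f)) :
    T.bdryForm w z = T.bdryForm w z' := by
  refine Finset.sum_congr rfl fun K _ => Finset.sum_congr rfl fun f hf => ?_
  congr 1
  exact setIntegral_congr_fun (T.dom_domain f).1.measurableSet fun x hx => by
    simp only [h K f hf hx]

theorem abs_bdryForm_le {w z : Fin T.numElem → Fin T.numFace → E n → ℝ} (hw : T.BdryL2 w)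
    (hz : T.BdryL2 z) : |T.bdryForm w z| ≤ √(T.bdryForm w w) * √(T.bdryForm z z) := by
  have h : ∀ t : ℝ, 0 ≤ T.bdryForm z z * (t * t) + 2 * T.bdryForm w z * t + T.bdryForm w w := by
    intro t
    have := bdryForm_self_nonneg (w + t • z)
    rw [bdryForm_add_smul_left hw hz (hw.add_smul hz t), bdryForm_add_smul_right hw hz hw,
      bdryForm_add_smul_right hw hz hz, bdryForm_comm z w] at this
    linarith
  have hd := discrim_le_zero h
  rw [discrim] at hd
  rw [← Real.sqrt_mul (bdryForm_self_nonneg w), ← Real.sqrt_sq_eq_abs]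
  exact Real.sqrt_le_sqrt (by nlinarith)

theorem sqrt_bdryForm_add_smul_le {w z : Fin T.numElem → Fin T.numFace → E n → ℝ}
    (hw : T.BdryL2 w) (hz : T.BdryL2 z) (c : ℝ) :
    √(T.bdryForm (w + c • z) (w + c • z)) ≤
      √(T.bdryForm w w) + |c| * √(T.bdryForm z z) := by
  have h := abs_bdryForm_le hw hz
  have h1 := Real.sq_sqrt (bdryForm_self_nonneg w)
  have h2 := Real.sq_sqrt (bdryForm_self_nonneg z)
  refine Real.sqrt_le_iff.2 ⟨by positivity, ?_⟩
  rw [bdryForm_add_smul_left hw hz (hw.add_smul hz c), bdryForm_add_smul_right hw hz hw,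
    bdryForm_add_smul_right hw hz hz, bdryForm_comm z w]
  have h3 : c * T.bdryForm w z ≤ |c| * (√(T.bdryForm w w) * √(T.bdryForm z z)) :=
    (le_abs_self _).trans (by rw [abs_mul]; gcongr)
  have h4 := sq_abs c
  calc T.bdryForm w w + c * T.bdryForm w z + c * (T.bdryForm w z + c * T.bdryForm z z)
      = T.bdryForm w w + 2 * (c * T.bdryForm w z) + c ^ 2 * T.bdryForm z z := by ring
    _ ≤ T.bdryForm w w + 2 * (|c| * (√(T.bdryForm w w) * √(T.bdryForm z z))) +
        c ^ 2 * T.bdryForm z z := by linarith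
    _ = √(T.bdryForm w w) ^ 2 + 2 * (|c| * (√(T.bdryForm w w) * √(T.bdryForm z z))) +
        |c| ^ 2 * √(T.bdryForm z z) ^ 2 := by rw [h1, h2, h4]
    _ = _ := by ring

/-- A function on `Γ` in the charts of the faces. -/
def chartFamily (T : PolyMesh n Ω) (μ : E (n + 1) → ℝ) :
    Fin T.numElem → Fin T.numFace → E n → ℝ := fun _ f x => μ (T.chart f x)

/-- The normal derivative of `Π^∇ u` in the charts of the faces. -/
def normalFamily (T : PolyMesh n Ω) (k : ℕ) (u : E (n + 1) → ℝ) :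
    Fin T.numElem → Fin T.numFace → E n → ℝ := fun K f x => T.dnPi k K f u (T.chart f x)

/-- The family `h̃_f⁻¹ Π⁰_∂ u` in the charts of the faces. -/
def projFamily (T : PolyMesh n Ω) (k' : ℕ) (u : E (n + 1) → ℝ) :
    Fin T.numElem → Fin T.numFace → E n → ℝ := fun K f =>
  (T.hK K)⁻¹ • l2Proj (T.dom f) k' fun y => T.trace K u (T.chart f y)

/-! ### Norms, pairing and form expressed through `bdryForm` -/

theorem hasTrace_trace {K : Fin T.numElem} {u : E (n + 1) → ℝ} (hu : ∃ g, T.HasTrace K u g) :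
    T.HasTrace K u (T.trace K u) := by
  rw [trace, dif_pos hu]
  exact hu.choose_spec

theorem isL2Proj_trace {u : E (n + 1) → ℝ} (hu : u ∈ T.Vh k M' M) {K : Fin T.numElem}
    {f : Fin T.numFace} (hf : f ∈ T.bdryFacesOf K) :
    IsL2Proj (T.dom f) k' (fun y => T.trace K u (T.chart f y))
      (l2Proj (T.dom f) k' fun y => T.trace K u (T.chart f y)) :=
  l2Proj_spec (T.dom_domain f).2.2.1 _
    ((hasTrace_trace ((hu.2 K).2.1.imp fun _ h => h.2)).2.1 f (Finset.mem_filter.1 hf).1)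

theorem projFamily_mem_P {u : E (n + 1) → ℝ} (hu : u ∈ T.Vh k M' M) {K : Fin T.numElem}
    {f : Fin T.numFace} (hf : f ∈ T.bdryFacesOf K) : T.projFamily k' u K f ∈ P n k' :=
  Submodule.smul_mem _ _ (isL2Proj_trace hu hf).1

theorem bdryL2_projFamily {u : E (n + 1) → ℝ} (hu : u ∈ T.Vh k M' M) :
    T.BdryL2 (T.projFamily k' u) := fun _ f hf =>
  memLp_of_continuous_of_isBounded (T.dom_domain f).2.2.1
    (continuous_of_mem_P (projFamily_mem_P hu hf))

theorem bdryL2_chartFamily {μ : E (n + 1) → ℝ} (hμ : μ ∈ T.Lh k') :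
    T.BdryL2 (T.chartFamily μ) := by
  intro K f hf
  obtain ⟨p, hp, h⟩ := hμ K f hf
  refine MemLp.ae_eq ?_ (memLp_of_continuous_of_isBounded (T.dom_domain f).2.2.1
    (continuous_of_mem_P hp))
  exact (ae_restrict_of_forall_mem (T.dom_domain f).1.measurableSet fun x hx => (h hx).symm)

theorem continuous_normalFamily {u : E (n + 1) → ℝ} (hu : u ∈ T.Vh k M' M) (K : Fin T.numElem)
    (f : Fin T.numFace) : Continuous (T.normalFamily k u K f) :=
  (((continuous_gradient_of_mem_P (piNabla_mem_P (hu.2 K))).comp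
    (T.chart f).continuous).inner continuous_const)

theorem bdryL2_normalFamily {u : E (n + 1) → ℝ} (hu : u ∈ T.Vh k M' M) :
    T.BdryL2 (T.normalFamily k u) := fun K f _ =>
  memLp_of_continuous_of_isBounded (T.dom_domain f).2.2.1 (continuous_normalFamily hu K f)

theorem normMinus_eq (μ : E (n + 1) → ℝ) :
    T.normMinus μ = √(T.bdryForm (T.chartFamily μ) (T.chartFamily μ)) := by
  simp only [normMinus, bdryForm, chartFamily, faceInt, sq]

/-- The scaling of `projFamily` is chosen so that h · h⁻² = h⁻¹ reproduces the weight of the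
discrete 1/2-norm. -/
theorem norm1h_eq (u : E (n + 1) → ℝ) :
    T.norm1h k' u = √((∑ K, dirichlet (T.elem K) u u) +
      T.bdryForm (T.projFamily k' u) (T.projFamily k' u)) := by
  simp only [norm1h, dirichlet, real_inner_self_eq_norm_sq]
  congr 2
  refine Finset.sum_congr rfl fun K _ => Finset.sum_congr rfl fun f _ => ?_
  have hK := (T.hK_pos K).ne'
  have : ∀ x, T.projFamily k' u K f x * T.projFamily k' u K f x = ((T.hK K)⁻¹) ^ 2 *
      l2Proj (T.dom f) k' (fun y => T.trace K u (T.chart f y)) x ^ 2 := by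
    intro x
    simp only [projFamily, Pi.smul_apply, smul_eq_mul]
    ring
  simp_rw [this]
  rw [integral_const_mul]
  field_simp

/-- On each face μ is a polynomial of degree ≤ k', so the trace may be replaced by its L²
projection; the weights h and h⁻¹ cancel. -/
theorem pairing_eq {μ u : E (n + 1) → ℝ} (hμ : μ ∈ T.Lh k') (hu : u ∈ T.Vh k M' M) :
    T.pairing μ u = T.bdryForm (T.chartFamily μ) (T.projFamily k' u) := by
  refine Finset.sum_congr rfl fun K _ => Finset.sum_congr rfl fun f hf => ?_
  obtain ⟨p, hp, h⟩ := hμ K f hf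
  have hm := (T.dom_domain f).1.measurableSet
  have h1 : T.faceInt f (fun x => μ x * T.trace K u x) =
      ∫ x in T.dom f, T.trace K u (T.chart f x) * p x :=
    setIntegral_congr_fun hm fun x hx => by
      simp only
      rw [show μ (T.chart f x) = p x from h hx, mul_comm]
  have h2 : ∫ x in T.dom f, T.chartFamily μ K f x * T.projFamily k' u K f x =
      ∫ x in T.dom f, (T.hK K)⁻¹ *
        (l2Proj (T.dom f) k' (fun y => T.trace K u (T.chart f y)) x * p x) :=
    setIntegral_congr_fun hm fun x hx => by
      simp only [chartFamily, projFamily, Pi.smul_apply, smul_eq_mul]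
      rw [show μ (T.chart f x) = p x from h hx]
      ring
  rw [h1, h2, integral_const_mul, (isL2Proj_trace hu hf).2 p hp,
    mul_inv_cancel_left₀ (T.hK_pos K).ne']

theorem aBH_eq {S : Fin T.numElem → LinearMap.BilinForm ℝ (E (n + 1) → ℝ)} {α : ℝ}
    {u l v μ : E (n + 1) → ℝ} (hu : u ∈ T.Vh k M' M) (hl : l ∈ T.Lh k')
    (hv : v ∈ T.Vh k M' M) (hμ : μ ∈ T.Lh k') :
    T.aBH k S α u l v μ = T.ah k S u v +
      T.bdryForm (T.chartFamily l) (T.projFamily k' v) +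
      T.bdryForm (T.chartFamily μ) (T.projFamily k' u) -
      α * T.bdryForm (T.chartFamily l + (1 : ℝ) • T.normalFamily k u)
        (T.chartFamily μ + (1 : ℝ) • T.normalFamily k v) := by
  rw [aBH, pairing_eq hl hv, pairing_eq hμ hu, one_smul, one_smul]
  rfl

/-! ### Normal derivatives of Π^∇ u -/

theorem InverseTrace.bdryInt_sq_le {C : ℝ} (hC : T.InverseTrace k C) (K : Fin T.numElem)
    {p : E (n + 1) → ℝ} (hp : p ∈ P (n + 1) k) :
    T.hK K * T.bdryInt K (fun x => p x ^ 2) ≤ C ^ 2 * ∫ x in T.elem K, p x ^ 2 := by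
  have hK := T.hK_pos K
  have h := hC K p hp
  have hA : 0 ≤ T.bdryInt K (fun x => p x ^ 2) :=
    Finset.sum_nonneg fun f _ => integral_nonneg fun x => sq_nonneg _
  have hI : 0 ≤ ∫ x in T.elem K, p x ^ 2 := integral_nonneg fun x => sq_nonneg _
  have h2 := pow_le_pow_left₀ (Real.sqrt_nonneg _) h 2
  rw [Real.sq_sqrt hA, mul_pow, mul_pow, Real.sq_sqrt hI, ← Real.rpow_natCast (_ ^ _ : ℝ),
    ← Real.rpow_mul hK.le] at h2
  norm_num at h2
  rw [Real.rpow_neg_one] at h2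
  calc T.hK K * T.bdryInt K (fun x => p x ^ 2)
      ≤ T.hK K * (C ^ 2 * (T.hK K)⁻¹ * ∫ x in T.elem K, p x ^ 2) := by gcongr
    _ = _ := by field_simp

/-- The normal is a unit vector, so |∂_ν p| ≤ |∇p|. The components of ∇p are again polynomials of
degree ≤ k, to which the inverse inequality applies one by one. -/
theorem bdryForm_normalFamily_le {C : ℝ} (hC : T.InverseTrace k C) {u : E (n + 1) → ℝ}
    (hu : u ∈ T.Vh k M' M) :
    T.bdryForm (T.normalFamily k u) (T.normalFamily k u) ≤
      C ^ 2 * ∑ K, dirichlet (T.elem K) (T.piNabla k K u) (T.piNabla k K u) := by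
  rw [bdryForm, Finset.mul_sum]
  refine Finset.sum_le_sum fun K _ => ?_
  obtain ⟨ho, -, hb, -⟩ := T.elem_domain K
  set p := T.piNabla k K u
  have hp : p ∈ P (n + 1) k := piNabla_mem_P (hu.2 K)
  have hg : ∀ i, (fun x => gradient p x i) ∈ P (n + 1) k := fun i =>
    P_mono _ (by omega) (gradient_mem_P hp i)
  have hgf : ∀ i f, Integrable (fun x => gradient p (T.chart f x) i ^ 2)
      (volume.restrict (T.dom f)) := fun i f =>
    memLp_one_iff_integrable.1 (memLp_of_continuous_of_isBounded (T.dom_domain f).2.2.1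
      (((continuous_of_mem_P (hg i)).comp (T.chart f).continuous).pow 2))
  have hgK : ∀ i, Integrable (fun x => gradient p x i ^ 2) (volume.restrict (T.elem K)) := fun i =>
    memLp_one_iff_integrable.1 (memLp_of_continuous_of_isBounded hb
      ((continuous_of_mem_P (hg i)).pow 2))
  have hface : ∀ f ∈ T.facesOf K,
      ∫ x in T.dom f, T.normalFamily k u K f x * T.normalFamily k u K f x ≤
        ∑ i, T.faceInt f fun x => gradient p x i ^ 2 := by
    intro f hf
    simp only [faceInt]
    rw [← integral_finsetSum _ fun i _ => hgf i f]
    refine integral_mono ?_ (integrable_finsetSum _ fun i _ => hgf i f) fun x => ?_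
    · have hc := continuous_normalFamily hu K f
      exact memLp_one_iff_integrable.1
        (memLp_of_continuous_of_isBounded (T.dom_domain f).2.2.1 (hc.mul hc))
    · have h1 : |T.normalFamily k u K f x| ≤ ‖gradient p (T.chart f x)‖ := by
        refine (abs_real_inner_le_norm _ _).trans ?_
        rw [T.normal_norm K f hf, mul_one]
      have h2 := EuclideanSpace.norm_sq_eq (gradient p (T.chart f x))
      simp only [Real.norm_eq_abs, sq_abs] at h2
      rw [← sq, ← sq_abs]
      simp only
      rw [← h2]
      gcongr
  have hdir : dirichlet (T.elem K) p p = ∑ i, ∫ x in T.elem K, gradient p x i ^ 2 := by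
    rw [← integral_finsetSum _ fun i _ => hgK i]
    refine integral_congr_ae ?_
    filter_upwards [(isWeakGrad_of_mem_P hb hp).wgrad_ae_eq ho] with x hx
    rw [hx, real_inner_self_eq_norm_sq, EuclideanSpace.norm_sq_eq]
    simp
  have hK := (T.hK_pos K).le
  calc ∑ f ∈ T.bdryFacesOf K, T.hK K *
        ∫ x in T.dom f, T.normalFamily k u K f x * T.normalFamily k u K f x
      ≤ ∑ f ∈ T.facesOf K, T.hK K *
        ∫ x in T.dom f, T.normalFamily k u K f x * T.normalFamily k u K f x :=
        Finset.sum_le_sum_of_subset_of_nonneg (Finset.filter_subset _ _) fun f _ _ =>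
          mul_nonneg hK (integral_nonneg fun x => mul_self_nonneg _)
    _ ≤ ∑ f ∈ T.facesOf K, T.hK K * ∑ i, T.faceInt f fun x => gradient p x i ^ 2 :=
        Finset.sum_le_sum fun f hf => mul_le_mul_of_nonneg_left (hface f hf) hK
    _ = ∑ i, T.hK K * T.bdryInt K fun x => gradient p x i ^ 2 := by
        simp only [bdryInt, Finset.mul_sum]
        exact Finset.sum_comm
    _ ≤ ∑ i, C ^ 2 * ∫ x in T.elem K, gradient p x i ^ 2 :=
        Finset.sum_le_sum fun i _ => hC.bdryInt_sq_le K (hg i)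
    _ = C ^ 2 * dirichlet (T.elem K) p p := by rw [hdir, Finset.mul_sum]

/-! ### Constructing multipliers -/

/-- Gluing is unambiguous: open faces are disjoint, charts are injective and a boundary face has
exactly one owner, so a point of Γ determines K, f and its chart coordinate. It turns h_K⁻¹ Π⁰_∂ u
into an admissible multiplier. -/
theorem exists_mem_Lh_eqOn {w : Fin T.numElem → Fin T.numFace → E n → ℝ}
    (hw : ∀ K, ∀ f ∈ T.bdryFacesOf K, w K f ∈ P n k') :
    ∃ μ ∈ T.Lh k', ∀ K, ∀ f ∈ T.bdryFacesOf K,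
      Set.EqOn (T.chartFamily μ K f) (w K f) (T.dom f) := by
  let Q : E (n + 1) → Fin T.numElem × Fin T.numFace × E n → Prop := fun y a =>
    a.2.1 ∈ T.bdryFacesOf a.1 ∧ a.2.2 ∈ T.dom a.2.1 ∧ T.chart a.2.1 a.2.2 = y
  let μ : E (n + 1) → ℝ := fun y =>
    if h : ∃ a, Q y a then w h.choose.1 h.choose.2.1 h.choose.2.2 else 0
  have hμ : ∀ K, ∀ f ∈ T.bdryFacesOf K,
      Set.EqOn (T.chartFamily μ K f) (w K f) (T.dom f) := by
    intro K f hf x hx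
    have h : ∃ a, Q (T.chart f x) a := ⟨(K, f, x), hf, hx, rfl⟩
    have hd : T.chartFamily μ K f x = w h.choose.1 h.choose.2.1 h.choose.2.2 := dif_pos h
    rw [hd]
    obtain ⟨h1, h2, h3⟩ := h.choose_spec
    generalize h.choose = a at h1 h2 h3 ⊢
    obtain ⟨K', f', x'⟩ := a
    simp only at h1 h2 h3 ⊢
    have hff : f' = f := by
      by_contra hne
      exact Set.disjoint_left.1 (T.face_disjoint hne) ⟨x', h2, h3⟩ ⟨x, hx, rfl⟩
    subst hff
    have hxx : x' = x := (T.chart f').injective h3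
    have hKK : K' = K := (T.bdry_owner f' (Finset.mem_filter.1 h1).2).unique
      (Finset.mem_filter.1 h1).1 (Finset.mem_filter.1 hf).1
    rw [hxx, hKK]
  exact ⟨μ, fun K f hf => ⟨w K f, hw K f hf, hμ K f hf⟩, hμ⟩

theorem Lh_add_smul {l μ : E (n + 1) → ℝ} (hl : l ∈ T.Lh k') (hμ : μ ∈ T.Lh k') (c : ℝ) :
    l + c • μ ∈ T.Lh k' := by
  intro K f hf
  obtain ⟨p, hp, hlp⟩ := hl K f hf
  obtain ⟨q, hq, hμq⟩ := hμ K f hf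
  refine ⟨p + c • q, Submodule.add_mem _ hp (Submodule.smul_mem _ _ hq), fun x hx => ?_⟩
  have h1 : l (T.chart f x) = p x := hlp hx
  have h2 : μ (T.chart f x) = q x := hμq hx
  simp [h1, h2]

end PolyMesh

namespace PolyMesh

/-! ### Continuity and stability of the Barbosa–Hughes form -/

variable {n : ℕ} {Ω : Set (E (n + 1))} {T : PolyMesh n Ω} {k k' : ℕ}
  {M' M : Fin T.numFace → Set (E n → ℝ)}
  {cLow cUp : ℝ} {S : Fin T.numElem → LinearMap.BilinForm ℝ (E (n + 1) → ℝ)}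

theorem normMinus_nonneg (μ : E (n + 1) → ℝ) : 0 ≤ T.normMinus μ := Real.sqrt_nonneg _

theorem norm1h_nonneg (u : E (n + 1) → ℝ) : 0 ≤ T.norm1h k' u := Real.sqrt_nonneg _

theorem normBH_nonneg (u μ : E (n + 1) → ℝ) : 0 ≤ T.normBH k' u μ :=
  add_nonneg (norm1h_nonneg u) (normMinus_nonneg μ)

theorem sqrt_sum_dirichlet_le_norm1h (u : E (n + 1) → ℝ) :
    √(∑ K, dirichlet (T.elem K) u u) ≤ T.norm1h k' u := by
  rw [norm1h_eq]
  exact Real.sqrt_le_sqrt (le_add_of_nonneg_right (bdryForm_self_nonneg _))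

theorem sqrt_bdryForm_projFamily_le_norm1h (u : E (n + 1) → ℝ) :
    √(T.bdryForm (T.projFamily k' u) (T.projFamily k' u)) ≤ T.norm1h k' u := by
  rw [norm1h_eq]
  exact Real.sqrt_le_sqrt (le_add_of_nonneg_left
    (Finset.sum_nonneg fun K _ => dirichlet_self_nonneg _ _))

theorem abs_ah_le (hM : T.IsFaceBases k M' M) (hS : T.IsStabilization k M' M cLow cUp S)
    (hc : 0 < cLow) (hC : 0 < cUp) {u v : E (n + 1) → ℝ} (hu : u ∈ T.Vh k M' M)
    (hv : v ∈ T.Vh k M' M) :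
    |T.ah k S u v| ≤ (1 + cUp) * (T.norm1h k' u * T.norm1h k' v) := by
  have h1 : |T.ah k S u v| ≤ (1 + cUp) *
      ∑ K, √(dirichlet (T.elem K) u u) * √(dirichlet (T.elem K) v v) := by
    rw [Finset.mul_sum]
    exact (Finset.abs_sum_le_sum_abs _ _).trans
      (Finset.sum_le_sum fun K _ => abs_ahK_le hM hS hc hC (hu.2 K) (hv.2 K))
  refine h1.trans (mul_le_mul_of_nonneg_left ?_ (by positivity))
  refine (Real.sum_sqrt_mul_sqrt_le _ (fun K => dirichlet_self_nonneg _ _)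
    fun K => dirichlet_self_nonneg _ _).trans ?_
  exact mul_le_mul (sqrt_sum_dirichlet_le_norm1h u) (sqrt_sum_dirichlet_le_norm1h v)
    (Real.sqrt_nonneg _) (norm1h_nonneg u)

theorem sqrt_bdryForm_normalFamily_le {C : ℝ} (hC0 : 0 < C) (hC : T.InverseTrace k C)
    {u : E (n + 1) → ℝ} (hu : u ∈ T.Vh k M' M) :
    √(T.bdryForm (T.normalFamily k u) (T.normalFamily k u)) ≤ C * T.norm1h k' u := by
  refine le_trans ?_ (mul_le_mul_of_nonneg_left (sqrt_sum_dirichlet_le_norm1h u) hC0.le)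
  have h : C * √(∑ K, dirichlet (T.elem K) u u) = √(C ^ 2 * ∑ K, dirichlet (T.elem K) u u) := by
    rw [Real.sqrt_mul (sq_nonneg C), Real.sqrt_sq hC0.le]
  rw [h]
  refine Real.sqrt_le_sqrt ((bdryForm_normalFamily_le hC hu).trans ?_)
  refine mul_le_mul_of_nonneg_left (Finset.sum_le_sum fun K _ => ?_) (sq_nonneg C)
  rw [dirichlet_eq_add (hu.2 K)]
  exact le_add_of_nonneg_right (dirichlet_self_nonneg _ _)

/-- Cauchy–Schwarz on each term: a_h contributes `1 + cUp`, the two pairings together contribute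
one, and each residual multiplier plus ν contributes a factor `1 + C`. The bound on the absolute
value also makes the supremum in the inf-sup condition finite. -/
theorem abs_aBH_le {C α : ℝ} (hC0 : 0 < C) (hC : T.InverseTrace k C)
    (hM : T.IsFaceBases k M' M) (hS : T.IsStabilization k M' M cLow cUp S)
    (hc : 0 < cLow) (hU : 0 < cUp) (hα : 0 < α) {u v l μ : E (n + 1) → ℝ}
    (hu : u ∈ T.Vh k M' M) (hv : v ∈ T.Vh k M' M) (hl : l ∈ T.Lh k') (hμ : μ ∈ T.Lh k') :
    |T.aBH k S α u l v μ| ≤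
      (2 + cUp + (1 + C) ^ 2) * (1 + α) * T.normBH k' u l * T.normBH k' v μ := by
  have hX := norm1h_nonneg (T := T) (k' := k') u
  have hX' := norm1h_nonneg (T := T) (k' := k') v
  have hY := normMinus_nonneg (T := T) l
  have hY' := normMinus_nonneg (T := T) μ
  have h1 := abs_ah_le (k' := k') hM hS hc hU hu hv
  have hpair : ∀ {w m : E (n + 1) → ℝ}, w ∈ T.Vh k M' M → m ∈ T.Lh k' →
      |T.bdryForm (T.chartFamily m) (T.projFamily k' w)| ≤ T.normMinus m * T.norm1h k' w := by
    intro w m hw hm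
    refine (abs_bdryForm_le (bdryL2_chartFamily hm) (bdryL2_projFamily hw)).trans ?_
    rw [← normMinus_eq]
    exact mul_le_mul_of_nonneg_left (sqrt_bdryForm_projFamily_le_norm1h w) (normMinus_nonneg m)
  have hres : ∀ {w m : E (n + 1) → ℝ}, w ∈ T.Vh k M' M → m ∈ T.Lh k' →
      √(T.bdryForm (T.chartFamily m + (1 : ℝ) • T.normalFamily k w)
        (T.chartFamily m + (1 : ℝ) • T.normalFamily k w)) ≤ (1 + C) * T.normBH k' w m := by
    intro w m hw hm
    refine (sqrt_bdryForm_add_smul_le (bdryL2_chartFamily hm) (bdryL2_normalFamily hw) 1).trans ?_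
    rw [← normMinus_eq, abs_one, one_mul, normBH]
    have h := sqrt_bdryForm_normalFamily_le (k' := k') hC0 hC hw
    have h2 := norm1h_nonneg (T := T) (k' := k') w
    have h3 := mul_nonneg hC0.le (normMinus_nonneg (T := T) m)
    linarith
  have h4 : |T.bdryForm (T.chartFamily l + (1 : ℝ) • T.normalFamily k u)
      (T.chartFamily μ + (1 : ℝ) • T.normalFamily k v)| ≤
      ((1 + C) * T.normBH k' u l) * ((1 + C) * T.normBH k' v μ) :=
    (abs_bdryForm_le ((bdryL2_chartFamily hl).add_smul (bdryL2_normalFamily hu) 1)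
      ((bdryL2_chartFamily hμ).add_smul (bdryL2_normalFamily hv) 1)).trans
      (mul_le_mul (hres hu hl) (hres hv hμ) (Real.sqrt_nonneg _)
        (mul_nonneg (by positivity) (normBH_nonneg u l)))
  rw [aBH_eq hu hl hv hμ]
  have h5 := hpair hv hl
  have h6 := hpair hu hμ
  have h7 : |α * T.bdryForm (T.chartFamily l + (1 : ℝ) • T.normalFamily k u)
      (T.chartFamily μ + (1 : ℝ) • T.normalFamily k v)| ≤
      α * (((1 + C) * T.normBH k' u l) * ((1 + C) * T.normBH k' v μ)) := by
    rw [abs_mul, abs_of_pos hα]; gcongr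
  refine (abs_sub _ _).trans ((add_le_add ((abs_add_le _ _).trans
    (add_le_add ((abs_add_le _ _).trans (add_le_add h1 h5)) h6)) h7).trans ?_)
  rw [normBH, normBH]
  generalize T.norm1h k' u = X at *
  generalize T.norm1h k' v = X' at *
  generalize T.normMinus l = Y at *
  generalize T.normMinus μ = Y' at *
  have e1 : (1 + cUp) * (X * X') ≤ (1 + cUp) * ((X + Y) * (X' + Y')) := by gcongr <;> linarith
  have e2 : Y * X' + Y' * X ≤ (X + Y) * (X' + Y') := by
    nlinarith [mul_nonneg hX hX', mul_nonneg hY hY']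
  have e3 : 0 ≤ (X + Y) * (X' + Y') := by positivity
  have e4 : 0 ≤ (2 + cUp) * α * ((X + Y) * (X' + Y')) := by positivity
  have e5 : 0 ≤ (1 + C) ^ 2 * ((X + Y) * (X' + Y')) := by positivity
  linarith

/-- Young's inequality bounds each mixed term by (α/4)t² + D²/16, using α < 1. The terms in N² then
total (5/4)αN² ≤ 5A/6, leaving A/6; D² keeps 1/4 - 1/8 and L² keeps 3α/4. -/
theorem stability_estimate {A B D L N C α c b₁ b₂ : ℝ} (hA : 0 ≤ A) (hα : 0 < α) (hα1 : α < 1)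
    (hαC : α * C ^ 2 ≤ 2 / 3) (hN : N ^ 2 ≤ C ^ 2 * A) (h₁ : b₁ ≤ L * D) (h₂ : b₂ ≤ N * D) :
    A / 6 + c * B + D ^ 2 / 8 + 3 / 4 * α * L ^ 2 ≤
      A + c * B + D ^ 2 / 4 - α / 4 * (b₁ + b₂) + α * L ^ 2 - α * N ^ 2 := by
  have e1 : α * N ^ 2 ≤ 2 / 3 * A := by
    calc α * N ^ 2 ≤ α * (C ^ 2 * A) := by gcongr
      _ = α * C ^ 2 * A := by ring
      _ ≤ 2 / 3 * A := by gcongr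
  have key : ∀ t : ℝ, α / 4 * (t * D) ≤ α / 4 * t ^ 2 + D ^ 2 / 16 := by
    intro t
    have h1 : 0 ≤ α * (t - D / 2) ^ 2 := by positivity
    have h2 : α * D ^ 2 ≤ D ^ 2 := by nlinarith [sq_nonneg D]
    nlinarith
  have e2 := key L
  have e3 := key N
  have e4 : α / 4 * (b₁ + b₂) ≤ α / 4 * (L * D) + α / 4 * (N * D) := by
    rw [← mul_add]; gcongr
  linarith

/-- The test pair `(u, -l + h̃_f⁻¹ Π⁰_∂ u / 4)` controls the norm of `(u, l)`. -/
theorem exists_test_multiplier {C α : ℝ} (hC : T.InverseTrace k C)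
    (hM : T.IsFaceBases k M' M) (hS : T.IsStabilization k M' M cLow cUp S)
    (hc : 0 < cLow) (hα : 0 < α) (hα1 : α < 1)
    (hαC : α * C ^ 2 ≤ 2 / 3) {u l : E (n + 1) → ℝ} (hu : u ∈ T.Vh k M' M) (hl : l ∈ T.Lh k') :
    ∃ μ ∈ T.Lh k', T.normBH k' u μ ≤ 2 * T.normBH k' u l ∧
      min (min (1 / 6) cLow) (min (1 / 8) (3 / 4 * α)) / 2 * T.normBH k' u l ^ 2 ≤
        T.aBH k S α u l u μ := by
  obtain ⟨m, hm, hmu⟩ := exists_mem_Lh_eqOn (T := T) (k' := k') (w := T.projFamily k' u)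
    fun K f hf => projFamily_mem_P hu hf
  have hfam : ∀ c : ℝ, T.chartFamily (c • l + (1 / 4 : ℝ) • m) =
      c • T.chartFamily l + (1 / 4 : ℝ) • T.chartFamily m := fun c => rfl
  set q := T.projFamily k' u with hq
  set lc := T.chartFamily l with hlc
  set mc := T.chartFamily m with hmc
  set ν := T.normalFamily k u with hν
  have ll : T.BdryL2 lc := bdryL2_chartFamily hl
  have lm : T.BdryL2 mc := bdryL2_chartFamily hm
  have lν : T.BdryL2 ν := bdryL2_normalFamily hu
  have lq : T.BdryL2 q := bdryL2_projFamily hu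
  -- The glued multiplier agrees with `q` on the open faces, which is all the form sees.
  have hr : ∀ w, T.bdryForm w mc = T.bdryForm w q := fun w => bdryForm_congr_right hmu
  have hr' : ∀ w, T.bdryForm mc w = T.bdryForm q w := fun w => by
    rw [bdryForm_comm, hr, bdryForm_comm]
  have l0 : T.BdryL2 0 := fun K f _ => MemLp.zero
  have hb0 : ∀ w, T.bdryForm 0 w = 0 := fun w => by simp [bdryForm]
  have hneg : T.BdryL2 ((-1 : ℝ) • lc) := by simpa using l0.add_smul ll (-1)
  have hμmem : (-1 : ℝ) • l + (1 / 4 : ℝ) • m ∈ T.Lh k' := by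
    refine Lh_add_smul ?_ hm _
    have h0 : (0 : E (n + 1) → ℝ) ∈ T.Lh k' := fun K f hf =>
      ⟨0, zero_mem _, fun x _ => rfl⟩
    simpa using Lh_add_smul h0 hl (-1)
  have hBneg : ∀ w, T.BdryL2 w → T.bdryForm ((-1 : ℝ) • lc) w = -T.bdryForm lc w := by
    intro w hw
    simpa [hb0] using bdryForm_add_smul_left l0 ll hw (-1)
  set A := ∑ K, dirichlet (T.elem K) (T.piNabla k K u) (T.piNabla k K u) with hA
  set B := ∑ K, dirichlet (T.elem K) (u - T.piNabla k K u) (u - T.piNabla k K u) with hB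
  have hA0 : 0 ≤ A := Finset.sum_nonneg fun K _ => dirichlet_self_nonneg _ _
  have hB0 : 0 ≤ B := Finset.sum_nonneg fun K _ => dirichlet_self_nonneg _ _
  set D := √(T.bdryForm q q) with hD
  set L := √(T.bdryForm lc lc) with hL
  set N := √(T.bdryForm ν ν) with hN
  have hDD : T.bdryForm q q = D ^ 2 := (Real.sq_sqrt (bdryForm_self_nonneg q)).symm
  have hLL : T.bdryForm lc lc = L ^ 2 := (Real.sq_sqrt (bdryForm_self_nonneg lc)).symm
  have hNN : T.bdryForm ν ν = N ^ 2 := (Real.sq_sqrt (bdryForm_self_nonneg ν)).symm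
  have hX : T.norm1h k' u ^ 2 = A + B + D ^ 2 := by
    rw [norm1h_eq, Real.sq_sqrt (add_nonneg (Finset.sum_nonneg fun K _ =>
      dirichlet_self_nonneg _ _) (bdryForm_self_nonneg _)), ← hq, hDD, hA, hB,
      ← Finset.sum_add_distrib]
    congr 1
    exact Finset.sum_congr rfl fun K _ => dirichlet_eq_add (hu.2 K)
  have hY : T.normMinus l = L := normMinus_eq l
  have hah : A + cLow * B ≤ T.ah k S u u := by
    rw [hA, hB, Finset.mul_sum, ← Finset.sum_add_distrib]
    exact Finset.sum_le_sum fun K _ => le_ahK_self hM hS (hu.2 K)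
  -- The sign of `-l` cancels both the pairing of `l` with `q` and the products of `l` with `ν`, and
  -- makes the term in L² positive.
  have hval : T.aBH k S α u l u ((-1 : ℝ) • l + (1 / 4 : ℝ) • m) = T.ah k S u u + D ^ 2 / 4 -
      α / 4 * (T.bdryForm lc q + T.bdryForm ν q) + α * L ^ 2 - α * N ^ 2 := by
    rw [aBH_eq hu hl hu hμmem, hfam]
    have lμ : T.BdryL2 ((-1 : ℝ) • lc + (1 / 4 : ℝ) • mc) := hneg.add_smul lm _
    rw [bdryForm_add_smul_left hneg lm lq, hBneg q lq, hr', hDD,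
      bdryForm_add_smul_left ll lν (lμ.add_smul lν 1), bdryForm_add_smul_right lμ lν ll,
      bdryForm_add_smul_right lμ lν lν, bdryForm_add_smul_right hneg lm ll,
      bdryForm_add_smul_right hneg lm lν, bdryForm_comm lc ((-1 : ℝ) • lc), hBneg _ ll,
      bdryForm_comm ν ((-1 : ℝ) • lc), hBneg _ lν, hr, hr, hLL, hNN]
    ring
  have hest := stability_estimate (A := A) (B := B) (D := D) (L := L) (N := N) (C := C) (c := cLow)
    (b₁ := T.bdryForm lc q) (b₂ := T.bdryForm ν q) hA0 hα hα1 hαC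
    (hNN ▸ bdryForm_normalFamily_le hC hu) ((le_abs_self _).trans (abs_bdryForm_le ll lq))
    ((le_abs_self _).trans (abs_bdryForm_le lν lq))
  refine ⟨_, hμmem, ?_, ?_⟩
  · have h1 : T.normMinus ((-1 : ℝ) • l + (1 / 4 : ℝ) • m) ≤ L + 1 / 4 * D := by
      rw [normMinus_eq, hfam]
      refine (sqrt_bdryForm_add_smul_le hneg lm _).trans (le_of_eq ?_)
      rw [hBneg _ hneg, bdryForm_comm, hBneg _ ll, neg_neg, hr, hr', abs_of_pos (by norm_num)]
    have h2 : D ≤ T.norm1h k' u := sqrt_bdryForm_projFamily_le_norm1h u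
    have h3 : 0 ≤ T.norm1h k' u := norm1h_nonneg u
    have h4 : 0 ≤ L := Real.sqrt_nonneg _
    rw [normBH, normBH, hY]
    linarith
  · rw [hval]
    set m₀ := min (min (1 / 6) cLow) (min (1 / 8) (3 / 4 * α))
    have m1 : m₀ ≤ 1 / 6 := (min_le_left _ _).trans (min_le_left _ _)
    have m2 : m₀ ≤ cLow := (min_le_left _ _).trans (min_le_right _ _)
    have m3 : m₀ ≤ 1 / 8 := (min_le_right _ _).trans (min_le_left _ _)
    have m4 : m₀ ≤ 3 / 4 * α := (min_le_right _ _).trans (min_le_right _ _)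
    have m0 : 0 < m₀ := by positivity
    -- From (X + L)² ≤ 2(X² + L²); this is the origin of the halving of `m₀`.
    have hZ : T.normBH k' u l ^ 2 ≤ 2 * (A + B + D ^ 2 + L ^ 2) := by
      rw [normBH, hY, ← hX]
      nlinarith [sq_nonneg (T.norm1h k' u - L)]
    calc m₀ / 2 * T.normBH k' u l ^ 2 ≤ m₀ / 2 * (2 * (A + B + D ^ 2 + L ^ 2)) := by gcongr
      _ = m₀ * A + m₀ * B + m₀ * D ^ 2 + m₀ * L ^ 2 := by ring
      _ ≤ 1 / 6 * A + cLow * B + 1 / 8 * D ^ 2 + 3 / 4 * α * L ^ 2 := by gcongr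
      _ ≤ _ := by linarith

/-- Divide the coercivity estimate by the norm of the test pair, which is at most twice that of (u,
l). `Cinv` governs coercivity, while `C` only guarantees boundedness and does not enter the final
constant. -/
theorem infSup {C Cinv α : ℝ} (hC0 : 0 < C) (hC : T.InverseTrace k C)
    (hCinv : T.InverseTrace k Cinv) (hM : T.IsFaceBases k M' M)
    (hS : T.IsStabilization k M' M cLow cUp S) (hc : 0 < cLow) (hU : 0 < cUp) (hα : 0 < α)
    (hα1 : α < 1) (hαC : α * Cinv ^ 2 ≤ 2 / 3) {u l : E (n + 1) → ℝ} (hu : u ∈ T.Vh k M' M)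
    (hl : l ∈ T.Lh k') :
    min (min (1 / 6) cLow) (min (1 / 8) (3 / 4 * α)) / 4 * T.normBH k' u l ≤
      ⨆ w : {w : (E (n + 1) → ℝ) × (E (n + 1) → ℝ) //
          w.1 ∈ T.Vh k M' M ∧ w.2 ∈ T.Lh k' ∧ T.normBH k' w.1 w.2 ≠ 0},
        T.aBH k S α u l w.1.1 w.1.2 / T.normBH k' w.1.1 w.1.2 := by
  set m₀ := min (min (1 / 6) cLow) (min (1 / 8) (3 / 4 * α))
  have m0 : 0 < m₀ := by positivity
  have hZ := normBH_nonneg (T := T) (k' := k') u l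
  obtain hZ0 | hZpos := hZ.eq_or_lt
  · rw [← hZ0, mul_zero]
    -- If the pair has norm zero, continuity makes every quotient vanish; an empty real supremum is
    -- zero by convention.
    refine Real.iSup_nonneg fun w => ?_
    have h := abs_aBH_le hC0 hC hM hS hc hU hα hu w.2.1 hl w.2.2.1
    rw [← hZ0, mul_zero, zero_mul] at h
    rw [abs_nonpos_iff.1 h, zero_div]
  · obtain ⟨μ, hμ, hle, hval⟩ := exists_test_multiplier hCinv hM hS hc hα hα1 hαC hu hl
    have hapos : 0 < T.aBH k S α u l u μ := lt_of_lt_of_le (by positivity) hval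
    have hWpos : 0 < T.normBH k' u μ := by
      -- A test pair of norm zero would force the form to vanish by continuity, against its
      -- positivity.
      refine (normBH_nonneg u μ).lt_of_ne fun h0 => ?_
      have h := abs_aBH_le hC0 hC hM hS hc hU hα hu hu hl hμ
      rw [← h0, mul_zero] at h
      exact hapos.ne' (abs_nonpos_iff.1 h)
    refine le_ciSup_of_le ?_ ⟨(u, μ), hu, hμ, hWpos.ne'⟩ ?_
    · refine ⟨(2 + cUp + (1 + C) ^ 2) * (1 + α) * T.normBH k' u l, ?_⟩
      rintro _ ⟨w, rfl⟩
      have hw : 0 < T.normBH k' w.1.1 w.1.2 := (normBH_nonneg _ _).lt_of_ne w.2.2.2.symm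
      exact (div_le_iff₀ hw).2 ((le_abs_self _).trans
        (abs_aBH_le hC0 hC hM hS hc hU hα hu w.2.1 hl w.2.2.1))
    · rw [le_div_iff₀ hWpos]
      refine le_trans ?_ hval
      calc m₀ / 4 * T.normBH k' u l * T.normBH k' u μ
          ≤ m₀ / 4 * T.normBH k' u l * (2 * T.normBH k' u l) := by gcongr
        _ = m₀ / 2 * T.normBH k' u l ^ 2 := by ring

end PolyMesh

end BHVEM

end

/-! ### Assembly of the three statements -/

theorem lemma3p1 (n k k' : ℕ) (hn : n = 1 ∨ n = 2) (hk : 1 ≤ k) (hk' : k' = k ∨ k' + 1 = k)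
    (γ₀ : ℝ) (hγ₀ : 0 < γ₀) (N₀ : ℕ) :
    -- the inverse constant exists, uniformly over all shape regular tessellations
    (∃ Cinv : ℝ, 0 < Cinv ∧ ∀ (Ω : Set (BHVEM.E (n + 1))) (T : BHVEM.PolyMesh n Ω),
      T.ShapeRegular γ₀ N₀ → T.InverseTrace k Cinv) ∧
    -- continuity
    (∀ cLow cUp : ℝ, 0 < cLow → 0 < cUp →
      ∃ C : ℝ, 0 < C ∧ ∀ (Ω : Set (BHVEM.E (n + 1))) (T : BHVEM.PolyMesh n Ω),
        T.ShapeRegular γ₀ N₀ →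
        ∀ (M' M : Fin T.numFace → Set (BHVEM.E n → ℝ))
          (S : Fin T.numElem → LinearMap.BilinForm ℝ (BHVEM.E (n + 1) → ℝ)) (α : ℝ),
          T.IsFaceBases k M' M → T.IsStabilization k M' M cLow cUp S → 0 < α →
          ∀ u ∈ T.Vh k M' M, ∀ v ∈ T.Vh k M' M, ∀ l ∈ T.Lh k', ∀ μ ∈ T.Lh k',
            T.aBH k S α u l v μ ≤ C * (1 + α) * T.normBH k' u l * T.normBH k' v μ) ∧
    -- discrete inf-sup condition
    (∀ Cinv α : ℝ, 0 < Cinv → 0 < α → α < min 1 (2 / (3 * Cinv ^ 2)) →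
      ∀ cLow cUp : ℝ, 0 < cLow → 0 < cUp →
      ∃ β : ℝ, 0 < β ∧ ∀ (Ω : Set (BHVEM.E (n + 1))) (T : BHVEM.PolyMesh n Ω),
        T.ShapeRegular γ₀ N₀ → T.InverseTrace k Cinv →
        ∀ (M' M : Fin T.numFace → Set (BHVEM.E n → ℝ))
          (S : Fin T.numElem → LinearMap.BilinForm ℝ (BHVEM.E (n + 1) → ℝ)),
          T.IsFaceBases k M' M → T.IsStabilization k M' M cLow cUp S →
          ∀ u ∈ T.Vh k M' M, ∀ l ∈ T.Lh k',
            β * T.normBH k' u l ≤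
              ⨆ w : {w : (BHVEM.E (n + 1) → ℝ) × (BHVEM.E (n + 1) → ℝ) //
                  w.1 ∈ T.Vh k M' M ∧ w.2 ∈ T.Lh k' ∧ T.normBH k' w.1 w.2 ≠ 0},
                T.aBH k S α u l w.1.1 w.1.2 / T.normBH k' w.1.1 w.1.2) := by
  refine ⟨BHVEM.PolyMesh.exists_inverseTrace n k hγ₀ N₀, fun cLow cUp hc hU => ?_,
    fun Cinv α hCinv hα hα' cLow cUp hc hU => ?_⟩
  · obtain ⟨C, hC0, hC⟩ := BHVEM.PolyMesh.exists_inverseTrace n k hγ₀ N₀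
    refine ⟨2 + cUp + (1 + C) ^ 2, by positivity, ?_⟩
    intro Ω T hT M' M S α hM hS hα u hu v hv l hl μ hμ
    exact (le_abs_self _).trans
      (BHVEM.PolyMesh.abs_aBH_le hC0 (hC Ω T hT) hM hS hc hU hα hu hv hl hμ)
  · obtain ⟨C, hC0, hC⟩ := BHVEM.PolyMesh.exists_inverseTrace n k hγ₀ N₀
    refine ⟨min (min (1 / 6) cLow) (min (1 / 8) (3 / 4 * α)) / 4, by positivity, ?_⟩
    intro Ω T hT hTinv M' M S hM hS u hu l hl
    -- This is the second entry of the minimum defining α₀, cleared of its denominator.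
    have hαC : α * Cinv ^ 2 ≤ 2 / 3 := by
      have h := (hα'.trans_le (min_le_right _ _)).le
      rw [le_div_iff₀ (by positivity)] at h
      linarith
    exact BHVEM.PolyMesh.infSup hC0 (hC Ω T hT) hTinv hM hS hc hU hα
      (hα'.trans_le (min_le_left _ _)) hαC hu hl
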